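/- Let $\mathcal C$ be a category with pullbacks and let $A$ be an object of $\mathcal C$. Write $\mathbb{S}\mathrm{q}(\mathcal C)$ for the (strict) double category of commutative squares in $\mathcal C$, let $\mathbb J,\mathbb K\to\mathbb{S}\mathrm{q}(\mathcal C)$ be double functors, and write $f$ for the morphism of $\mathcal C$ underlying a vertical morphism $\mathbf f$. A $(\mathbb J,\mathbb K)$-lifting operation $\phi$ chooses, for every vertical $\mathbf f$ of $\mathbb J$, every vertical $\mathbf g$ of $\mathbb K$ and every commutative square $(u,v):f\to g$, a diagonal filler $\phi_{\mathbf f,\mathbf g}(u,v)$, so that the choice is natural with respect to the squares of $\mathbb J$ and $\mathbb K$ and satisfies $\phi_{\mathbf f,\mathbf g'}(\phi_{\mathbf f',\mathbf g\mathbf g'}(u,vf),\phi_{\mathbf f\mathbf f',\mathbf g}(g'u,v))=\phi_{\mathbf f\mathbf f',\mathbf g\mathbf g'}(u,v)$ for vertical composites; the triple $(\mathbb J,\phi,\mathbb K)$ is then a lifting structure. Let ${}^{\pitchfork}\mathbb K$ be the double category over $\mathbb{S}\mathrm{q}(\mathcal C)$ with the objects and horizontal morphisms of $\mathcal C$, whose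 vertical morphisms are the morphisms of $\mathcal C$ equipped with a lifting operation against $\mathbb K$ (respecting the squares and vertical composition of $\mathbb K$), and whose squares are the commutative squares compatible with these operations; vertical composites lift along the first morphism and then along the second. Let $\mathbb J^{\pitchfork}$ be defined dually. A lifting structure is closed if the induced double functors $\phi_l:\mathbb J\to{}^{\pitchfork}\mathbb K$ and $\phi_r:\mathbb K\to\mathbb J^{\pitchfork}$ are invertible. The slice $\mathbb J/A\to\mathbb{S}\mathrm{q}(\mathcal C/A)$ is the pullback of $\mathbb J$ along $\mathbb{S}\mathrm{q}(\mathrm{dom}):\mathbb{S}\mathrm{q}(\mathcal C/A)\to\mathbb{S}\mathrm{q}(\mathcal C)$, and $\phi/A$ is the $(\mathbb J/A,\mathbb K/A)$-lifting operation which uses the fillers of $\phi$. Call $\mathbb J$ a comprehension double category if $\mathrm{cod}\circ\mathbb J_1:\mathbb J_1\to\mathcal C$ is a Grothendieck fibration, $\mathbb J_1\to\mathrm{Ar}(\mathcal C)$ sends its cartesian morphisms to cartesian morphisms for $\mathrm{cod}:\mathrm{Ar}(\mathcal C)\to\mathcal C$ (pullback squares), and the cartesian squares of $\mathbb J$ are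 closed under vertical composition. Then: (1) If $(\mathbb J,\phi,\mathbb K)$ is a closed lifting structure on $\mathcal C$, then $(\mathbb J/A,\phi/A,\mathbb K/A)$ is a closed lifting structure on $\mathcal C/A$. (2) If $\mathbb J$ is a comprehension double category and its object component $\mathbb J_0\to\mathcal C$ is an isomorphism of categories, then the canonical double functor $(\lambda/A)_l:({}^{\pitchfork}\mathbb J)/A\to{}^{\pitchfork}(\mathbb J/A)$, induced by slicing the canonical lifting operation $\lambda$ of ${}^{\pitchfork}\mathbb J$ against $\mathbb J$, is an isomorphism. (3) $\mathbb J^{\pitchfork}\to\mathbb{S}\mathrm{q}(\mathcal C)$ is a comprehension double category, for every $\mathbb J$. -/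

import Mathlib

open CategoryTheory CategoryTheory.Limits

attribute [-instance] catToReflQuiver

universe w₁ w₂ w₃ x₁ x₂ x₃ v u v₁ u₁ v₂ u₂ v₃ u₃

/-- A (strict) double category whose category of objects and horizontal morphisms is `O`:
`V A B` is the type of vertical morphisms from `A` to `B`, and `Sq f g s t` is the type of squares
with left side `f`, right side `g`, top `s` and bottom `t`. Equations between squares whose
boundaries agree only up to a propositional equality are stated with `HEq`. -/
structure DoubleCategory (O : Type u) [Category.{v} O] where
  V : O → O → Type w₁
  Sq : ∀ {A B A' B' : O}, V A B → V A' B' → (A ⟶ A') → (B ⟶ B') → Type x₁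
  hId : ∀ {A B : O} (f : V A B), Sq f f (𝟙 A) (𝟙 B)
  hComp : ∀ {A B A' B' A'' B'' : O} {f : V A B} {g : V A' B'} {h : V A'' B''}
    {s : A ⟶ A'} {t : B ⟶ B'} {s' : A' ⟶ A''} {t' : B' ⟶ B''},
    Sq f g s t → Sq g h s' t' → Sq f h (s ≫ s') (t ≫ t')
  vId : ∀ A : O, V A A
  vComp : ∀ {A B D : O}, V A B → V B D → V A D
  vIdSq : ∀ {A A' : O} (s : A ⟶ A'), Sq (vId A) (vId A') s s
  vCompSq : ∀ {A B D A' B' D' : O} {f : V A B} {g : V B D} {f' : V A' B'} {g' : V B' D'}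
    {s : A ⟶ A'} {t : B ⟶ B'} {r : D ⟶ D'},
    Sq f f' s t → Sq g g' t r → Sq (vComp f g) (vComp f' g') s r
  hId_hComp : ∀ {A B A' B' : O} {f : V A B} {g : V A' B'} {s : A ⟶ A'} {t : B ⟶ B'}
    (α : Sq f g s t), HEq (hComp (hId f) α) α
  hComp_hId : ∀ {A B A' B' : O} {f : V A B} {g : V A' B'} {s : A ⟶ A'} {t : B ⟶ B'}
    (α : Sq f g s t), HEq (hComp α (hId g)) α
  hComp_assoc : ∀ {A B A' B' A'' B'' A₃ B₃ : O} {f : V A B} {g : V A' B'} {h : V A'' B''}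
    {k : V A₃ B₃} {s : A ⟶ A'} {t : B ⟶ B'} {s' : A' ⟶ A''} {t' : B' ⟶ B''}
    {s'' : A'' ⟶ A₃} {t'' : B'' ⟶ B₃}
    (α : Sq f g s t) (β : Sq g h s' t') (γ : Sq h k s'' t''),
    HEq (hComp (hComp α β) γ) (hComp α (hComp β γ))
  vId_vComp : ∀ {A B : O} (f : V A B), vComp (vId A) f = f
  vComp_vId : ∀ {A B : O} (f : V A B), vComp f (vId B) = f
  vComp_assoc : ∀ {A B D E : O} (f : V A B) (g : V B D) (h : V D E),
    vComp (vComp f g) h = vComp f (vComp g h)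
  vIdSq_vCompSq : ∀ {A B A' B' : O} {f : V A B} {g : V A' B'} {s : A ⟶ A'} {t : B ⟶ B'}
    (α : Sq f g s t), HEq (vCompSq (vIdSq s) α) α
  vCompSq_vIdSq : ∀ {A B A' B' : O} {f : V A B} {g : V A' B'} {s : A ⟶ A'} {t : B ⟶ B'}
    (α : Sq f g s t), HEq (vCompSq α (vIdSq t)) α
  vCompSq_assoc : ∀ {A B D E A' B' D' E' : O} {f : V A B} {g : V B D} {h : V D E}
    {f' : V A' B'} {g' : V B' D'} {h' : V D' E'}
    {s : A ⟶ A'} {t : B ⟶ B'} {r : D ⟶ D'} {q : E ⟶ E'}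
    (α : Sq f f' s t) (β : Sq g g' t r) (γ : Sq h h' r q),
    HEq (vCompSq (vCompSq α β) γ) (vCompSq α (vCompSq β γ))
  vIdSq_id : ∀ A : O, vIdSq (𝟙 A) = hId (vId A)
  vIdSq_comp : ∀ {A A' A'' : O} (s : A ⟶ A') (s' : A' ⟶ A''),
    vIdSq (s ≫ s') = hComp (vIdSq s) (vIdSq s')
  vCompSq_hId : ∀ {A B D : O} (f : V A B) (g : V B D),
    vCompSq (hId f) (hId g) = hId (vComp f g)
  interchange : ∀ {A B D A' B' D' A'' B'' D'' : O}
    {f : V A B} {g : V B D} {f' : V A' B'} {g' : V B' D'} {f'' : V A'' B''} {g'' : V B'' D''}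
    {s : A ⟶ A'} {t : B ⟶ B'} {r : D ⟶ D'} {s' : A' ⟶ A''} {t' : B' ⟶ B''} {r' : D' ⟶ D''}
    (α : Sq f f' s t) (β : Sq g g' t r) (α' : Sq f' f'' s' t') (β' : Sq g' g'' t' r'),
    hComp (vCompSq α β) (vCompSq α' β') = vCompSq (hComp α α') (hComp β β')

/-- Two squares of a double category in which squares are propositions are always equal. -/
theorem plift_heq {p q : Prop} (a : PLift p) (b : PLift q) : HEq a b := by
  cases a with | up a => cases b with | up b =>
  obtain rfl : p = q := propext ⟨fun _ => b, fun _ => a⟩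
  rfl

/-- The double category of squares in `C`. -/
def squares (C : Type u) [Category.{v} C] : DoubleCategory.{v, 0} C where
  V A B := A ⟶ B
  Sq f g s t := PLift (s ≫ g = f ≫ t)
  hId f := ⟨by simp⟩
  hComp α β := ⟨by rw [Category.assoc, β.down, ← Category.assoc, α.down, Category.assoc]⟩
  vId A := 𝟙 A
  vComp f g := f ≫ g
  vIdSq s := ⟨by simp⟩
  vCompSq α β := ⟨by rw [← Category.assoc, α.down, Category.assoc, β.down, Category.assoc]⟩
  hId_hComp _ := plift_heq _ _
  hComp_hId _ := plift_heq _ _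
  hComp_assoc _ _ _ := plift_heq _ _
  vId_vComp _ := Category.id_comp _
  vComp_vId _ := Category.comp_id _
  vComp_assoc _ _ _ := Category.assoc _ _ _
  vIdSq_vCompSq _ := plift_heq _ _
  vCompSq_vIdSq _ := plift_heq _ _
  vCompSq_assoc _ _ _ := plift_heq _ _
  vIdSq_id _ := rfl
  vIdSq_comp _ _ := rfl
  vCompSq_hId _ _ := rfl
  interchange _ _ _ _ := rfl

/-- A vertical morphism of `D`, bundled with its source and target. -/
structure DoubleCategory.Vert {O : Type u} [Category.{v} O] (D : DoubleCategory.{w₁, x₁} O) where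
  src : O
  tgt : O
  vert : D.V src tgt

/-- A square of `D`, bundled with its top and bottom. -/
@[ext]
structure DoubleCategory.Vert.Hom {O : Type u} [Category.{v} O] {D : DoubleCategory.{w₁, x₁} O}
    (f g : D.Vert) where
  top : f.src ⟶ g.src
  bot : f.tgt ⟶ g.tgt
  sq : D.Sq f.vert g.vert top bot

/-- The category of arrows of a double category: vertical morphisms and squares. -/
instance DoubleCategory.Vert.category {O : Type u} [Category.{v} O]
    (D : DoubleCategory.{w₁, x₁} O) : Category D.Vert where
  Hom := DoubleCategory.Vert.Hom
  id f := ⟨𝟙 _, 𝟙 _, D.hId f.vert⟩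
  comp α β := ⟨α.top ≫ β.top, α.bot ≫ β.bot, D.hComp α.sq β.sq⟩
  id_comp α := DoubleCategory.Vert.Hom.ext (Category.id_comp _) (Category.id_comp _)
    (D.hId_hComp α.sq)
  comp_id α := DoubleCategory.Vert.Hom.ext (Category.comp_id _) (Category.comp_id _)
    (D.hComp_hId α.sq)
  assoc α β γ := DoubleCategory.Vert.Hom.ext (Category.assoc _ _ _) (Category.assoc _ _ _)
    (D.hComp_assoc α.sq β.sq γ.sq)

/-- A double functor. -/
structure DoubleFunctor {O : Type u₁} [Category.{v₁} O] {P : Type u₂} [Category.{v₂} P]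
    (D : DoubleCategory.{w₁, x₁} O) (E : DoubleCategory.{w₂, x₂} P) where
  base : O ⥤ P
  vert : ∀ {A B : O}, D.V A B → E.V (base.obj A) (base.obj B)
  sq : ∀ {A B A' B' : O} {f : D.V A B} {g : D.V A' B'} {s : A ⟶ A'} {t : B ⟶ B'},
    D.Sq f g s t → E.Sq (vert f) (vert g) (base.map s) (base.map t)
  vert_id : ∀ A : O, vert (D.vId A) = E.vId (base.obj A)
  vert_comp : ∀ {A B F : O} (f : D.V A B) (g : D.V B F),
    vert (D.vComp f g) = E.vComp (vert f) (vert g)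
  sq_hId : ∀ {A B : O} (f : D.V A B), HEq (sq (D.hId f)) (E.hId (vert f))
  sq_hComp : ∀ {A B A' B' A'' B'' : O} {f : D.V A B} {g : D.V A' B'} {h : D.V A'' B''}
    {s : A ⟶ A'} {t : B ⟶ B'} {s' : A' ⟶ A''} {t' : B' ⟶ B''}
    (α : D.Sq f g s t) (β : D.Sq g h s' t'),
    HEq (sq (D.hComp α β)) (E.hComp (sq α) (sq β))
  sq_vIdSq : ∀ {A A' : O} (s : A ⟶ A'), HEq (sq (D.vIdSq s)) (E.vIdSq (base.map s))
  sq_vCompSq : ∀ {A B F A' B' F' : O} {f : D.V A B} {g : D.V B F} {f' : D.V A' B'}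
    {g' : D.V B' F'} {s : A ⟶ A'} {t : B ⟶ B'} {r : F ⟶ F'}
    (α : D.Sq f f' s t) (β : D.Sq g g' t r),
    HEq (sq (D.vCompSq α β)) (E.vCompSq (sq α) (sq β))

namespace DoubleFunctor

section Basic

variable {O : Type u₁} [Category.{v₁} O] {P : Type u₂} [Category.{v₂} P]
  {Q : Type u₃} [Category.{v₃} Q]
  {D : DoubleCategory.{w₁, x₁} O} {E : DoubleCategory.{w₂, x₂} P} {F : DoubleCategory.{w₃, x₃} Q}

theorem sq_heq (G : DoubleFunctor D E) {A B A' B' : O} {f f' : D.V A B} {g g' : D.V A' B'}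
    {s s' : A ⟶ A'} {t t' : B ⟶ B'} {α : D.Sq f g s t} {α' : D.Sq f' g' s' t'}
    (hf : f = f') (hg : g = g') (hs : s = s') (ht : t = t') (h : HEq α α') :
    HEq (G.sq α) (G.sq α') := by
  subst hf hg hs ht
  cases h
  rfl

/-- The identity double functor. -/
def id (D : DoubleCategory.{w₁, x₁} O) : DoubleFunctor D D where
  base := 𝟭 O
  vert f := f
  sq α := α
  vert_id _ := rfl
  vert_comp _ _ := rfl
  sq_hId _ := HEq.rfl
  sq_hComp _ _ := HEq.rfl
  sq_vIdSq _ := HEq.rfl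
  sq_vCompSq _ _ := HEq.rfl

/-- The composite of two double functors, in diagrammatic order. -/
def comp (G : DoubleFunctor D E) (H : DoubleFunctor E F) : DoubleFunctor D F where
  base := G.base ⋙ H.base
  vert f := H.vert (G.vert f)
  sq α := H.sq (G.sq α)
  vert_id A := by rw [G.vert_id, H.vert_id]; rfl
  vert_comp f g := by rw [G.vert_comp, H.vert_comp]
  sq_hId f := (H.sq_heq rfl rfl (G.base.map_id _) (G.base.map_id _) (G.sq_hId f)).trans
    (H.sq_hId _)
  sq_hComp α β := (H.sq_heq rfl rfl (G.base.map_comp _ _) (G.base.map_comp _ _)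
    (G.sq_hComp α β)).trans (H.sq_hComp _ _)
  sq_vIdSq s := (H.sq_heq (G.vert_id _) (G.vert_id _) rfl rfl (G.sq_vIdSq s)).trans
    (H.sq_vIdSq _)
  sq_vCompSq α β := (H.sq_heq (G.vert_comp _ _) (G.vert_comp _ _) rfl rfl
    (G.sq_vCompSq α β)).trans (H.sq_vCompSq _ _)

/-- A double functor is invertible if it has a two-sided inverse double functor. -/
def Invertible (G : DoubleFunctor D E) : Prop :=
  ∃ H : DoubleFunctor E D, G.comp H = DoubleFunctor.id D ∧ H.comp G = DoubleFunctor.id E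

end Basic

section OverSquares

variable {C : Type u} [Category.{v} C] {O : Type u₁} [Category.{v₁} O]
  {D : DoubleCategory.{w₁, x₁} O} (J : DoubleFunctor D (squares C))

/-- The morphism of `C` underlying a vertical morphism of `D`. -/
def arrow {A B : O} (f : D.V A B) : J.base.obj A ⟶ J.base.obj B := J.vert f

theorem arrow_id (A : O) : J.arrow (D.vId A) = 𝟙 (J.base.obj A) := J.vert_id A

theorem arrow_comp {A B F : O} (f : D.V A B) (g : D.V B F) :
    J.arrow (D.vComp f g) = J.arrow f ≫ J.arrow g := J.vert_comp f g

theorem arrow_sq {A B A' B' : O} {f : D.V A B} {g : D.V A' B'} {s : A ⟶ A'} {t : B ⟶ B'}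
    (α : D.Sq f g s t) : J.base.map s ≫ J.arrow g = J.arrow f ≫ J.base.map t := (J.sq α).down

/-- The functor from the category of arrows of `D` to the arrow category of `C`. -/
def arr : D.Vert ⥤ Arrow C where
  obj f := Arrow.mk (J.arrow f.vert)
  map α := Arrow.homMk (J.base.map α.top) (J.base.map α.bot) (J.arrow_sq α.sq)
  map_id f := by
    ext
    · exact J.base.map_id _
    · exact J.base.map_id _
  map_comp α β := by
    ext
    · exact J.base.map_comp _ _
    · exact J.base.map_comp _ _

/-- The codomain functor from the category of arrows of `D` to `C`. -/
def codomain : D.Vert ⥤ C := J.arr ⋙ Arrow.rightFunc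

/-- A square of `D` is cartesian if it is a cartesian morphism with respect to the codomain
functor. -/
def IsCartesianSq {f g : D.Vert} (α : f ⟶ g) : Prop :=
  J.codomain.IsStronglyCartesian (J.codomain.map α) α

/-- Comprehension double categories. -/
structure IsComprehension : Prop where
  fibration : J.codomain.IsFibered
  cartesian : ∀ {f g : D.Vert} (α : f ⟶ g), J.IsCartesianSq α →
    (Arrow.rightFunc : Arrow C ⥤ C).IsStronglyCartesian (Arrow.rightFunc.map (J.arr.map α))
      (J.arr.map α)
  vertical : ∀ {X Y Z X' Y' Z' : O} {g' : D.V X' Y'} {h' : D.V Y' Z'} {g : D.V X Y}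
    {h : D.V Y Z} {s : X' ⟶ X} {t : Y' ⟶ Y} {r : Z' ⟶ Z}
    (α : D.Sq g' g s t) (β : D.Sq h' h t r),
    J.IsCartesianSq (f := ⟨X', Y', g'⟩) (g := ⟨X, Y, g⟩) ⟨s, t, α⟩ →
    J.IsCartesianSq (f := ⟨Y', Z', h'⟩) (g := ⟨Y, Z, h⟩) ⟨t, r, β⟩ →
    J.IsCartesianSq (f := ⟨X', Z', D.vComp g' h'⟩) (g := ⟨X, Z, D.vComp g h⟩)
      ⟨s, r, D.vCompSq α β⟩

/-- The horizontal component of `J` is an isomorphism of categories, so that `J` puts no additional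
structure on the objects of `C`. -/
def BaseIso : Prop :=
  ∃ G : C ⥤ O, J.base ⋙ G = 𝟭 O ∧ G ⋙ J.base = 𝟭 C

end OverSquares

end DoubleFunctor

section Slice

variable {C : Type u} [Category.{v} C] {O : Type u₁} [Category.{v₁} O]
  {D : DoubleCategory.{w₁, x₁} O} (J : DoubleFunctor D (squares C)) (A : C)

/-- The slice double category: the pullback of `J` along the domain functor from squares in `C/A`
to squares in `C`. An object is an object `X` of `D` with a morphism `J X ⟶ A`; a vertical morphism
is a vertical morphism of `D` over `A`, and a square is a square of `D` whose top and bottom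
are over `A`. -/
def sliceCat : DoubleCategory.{w₁, x₁} (CostructuredArrow J.base A) where
  V X Y := {f : D.V X.left Y.left // J.arrow f ≫ Y.hom = X.hom}
  Sq f g s t := D.Sq f.1 g.1 s.left t.left
  hId f := D.hId f.1
  hComp α β := D.hComp α β
  vId X := ⟨D.vId X.left, by rw [J.arrow_id]; exact Category.id_comp _⟩
  vComp f g := ⟨D.vComp f.1 g.1, by rw [J.arrow_comp, Category.assoc, g.2, f.2]⟩
  vIdSq s := D.vIdSq s.left
  vCompSq α β := D.vCompSq α β
  hId_hComp α := D.hId_hComp α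
  hComp_hId α := D.hComp_hId α
  hComp_assoc α β γ := D.hComp_assoc α β γ
  vId_vComp f := Subtype.ext (D.vId_vComp f.1)
  vComp_vId f := Subtype.ext (D.vComp_vId f.1)
  vComp_assoc f g h := Subtype.ext (D.vComp_assoc f.1 g.1 h.1)
  vIdSq_vCompSq α := D.vIdSq_vCompSq α
  vCompSq_vIdSq α := D.vCompSq_vIdSq α
  vCompSq_assoc α β γ := D.vCompSq_assoc α β γ
  vIdSq_id X := D.vIdSq_id X.left
  vIdSq_comp s s' := D.vIdSq_comp s.left s'.left
  vCompSq_hId f g := D.vCompSq_hId f.1 g.1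
  interchange α β α' β' := D.interchange α β α' β'

/-- The slice double functor to squares in `C/A`. -/
def DoubleFunctor.slice : DoubleFunctor (sliceCat J A) (squares (Over A)) where
  base := CostructuredArrow.toOver J.base A
  vert {X Y} f := (Over.homMk (J.arrow f.1) f.2 : Over.mk X.hom ⟶ Over.mk Y.hom)
  sq α := ⟨by ext; exact J.arrow_sq α⟩
  vert_id X := by apply Over.OverMorphism.ext; exact J.arrow_id X.left
  vert_comp f g := by apply Over.OverMorphism.ext; exact J.arrow_comp f.1 g.1
  sq_hId _ := plift_heq _ _
  sq_hComp _ _ := plift_heq _ _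
  sq_vIdSq _ := plift_heq _ _
  sq_vCompSq _ _ := plift_heq _ _

end Slice

section Lifting

variable {C : Type u} [Category.{v} C] {O : Type u₁} [Category.{v₁} O]
  {P : Type u₂} [Category.{v₂} P]
  {D : DoubleCategory.{w₁, x₁} O} {E : DoubleCategory.{w₂, x₂} P}

/-- A lifting operation for a pair of double functors to squares in `C`. In `vertical`, the first
two problems commute because the given one does, and the third is asserted to commute. -/
structure LiftingOperation (J : DoubleFunctor D (squares C)) (K : DoubleFunctor E (squares C)) where
  lift : ∀ {a b : O} {c d : P} (f : D.V a b) (g : E.V c d)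
    (p : J.base.obj a ⟶ K.base.obj c) (q : J.base.obj b ⟶ K.base.obj d),
    p ≫ K.arrow g = J.arrow f ≫ q → (J.base.obj b ⟶ K.base.obj c)
  fac_left : ∀ {a b : O} {c d : P} (f : D.V a b) (g : E.V c d)
    (p : J.base.obj a ⟶ K.base.obj c) (q : J.base.obj b ⟶ K.base.obj d)
    (e : p ≫ K.arrow g = J.arrow f ≫ q), J.arrow f ≫ lift f g p q e = p
  fac_right : ∀ {a b : O} {c d : P} (f : D.V a b) (g : E.V c d)
    (p : J.base.obj a ⟶ K.base.obj c) (q : J.base.obj b ⟶ K.base.obj d)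
    (e : p ≫ K.arrow g = J.arrow f ≫ q), lift f g p q e ≫ K.arrow g = q
  natural : ∀ {a b a' b' : O} {c d c' d' : P} {f' : D.V a' b'} {f : D.V a b} {g : E.V c d}
    {g' : E.V c' d'} {s : a' ⟶ a} {t : b' ⟶ b} {y : c ⟶ c'} {z : d ⟶ d'}
    (_ : D.Sq f' f s t) (_ : E.Sq g g' y z)
    (p : J.base.obj a ⟶ K.base.obj c) (q : J.base.obj b ⟶ K.base.obj d)
    (e : p ≫ K.arrow g = J.arrow f ≫ q)
    (e' : (J.base.map s ≫ p ≫ K.base.map y) ≫ K.arrow g' =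
      J.arrow f' ≫ J.base.map t ≫ q ≫ K.base.map z),
    J.base.map t ≫ lift f g p q e ≫ K.base.map y =
      lift f' g' (J.base.map s ≫ p ≫ K.base.map y) (J.base.map t ≫ q ≫ K.base.map z) e'
  vertical : ∀ {a b c : O} {x y z : P} (f' : D.V a b) (f : D.V b c) (g' : E.V x y) (g : E.V y z)
    (p : J.base.obj a ⟶ K.base.obj x) (q : J.base.obj c ⟶ K.base.obj z)
    (e : p ≫ K.arrow (E.vComp g' g) = J.arrow (D.vComp f' f) ≫ q)
    (e₁ : p ≫ K.arrow (E.vComp g' g) = J.arrow f' ≫ J.arrow f ≫ q)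
    (e₂ : (p ≫ K.arrow g') ≫ K.arrow g = J.arrow (D.vComp f' f) ≫ q),
    ∃ e₃ : lift f' (E.vComp g' g) p (J.arrow f ≫ q) e₁ ≫ K.arrow g' =
        J.arrow f ≫ lift (D.vComp f' f) g (p ≫ K.arrow g') q e₂,
      lift f g' (lift f' (E.vComp g' g) p (J.arrow f ≫ q) e₁)
          (lift (D.vComp f' f) g (p ≫ K.arrow g') q e₂) e₃ =
        lift (D.vComp f' f) (E.vComp g' g) p q e

/-- A vertical morphism of the left class of `K`: a morphism of `C` with a lifting operation
against `K`, respecting the squares and the vertical composition of `E`. -/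
structure LeftLift (K : DoubleFunctor E (squares C)) (X Y : C) where
  hom : X ⟶ Y
  lift : ∀ {c d : P} (g : E.V c d) (p : X ⟶ K.base.obj c) (q : Y ⟶ K.base.obj d),
    p ≫ K.arrow g = hom ≫ q → (Y ⟶ K.base.obj c)
  fac_left : ∀ {c d : P} (g : E.V c d) (p : X ⟶ K.base.obj c) (q : Y ⟶ K.base.obj d)
    (e : p ≫ K.arrow g = hom ≫ q), hom ≫ lift g p q e = p
  fac_right : ∀ {c d : P} (g : E.V c d) (p : X ⟶ K.base.obj c) (q : Y ⟶ K.base.obj d)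
    (e : p ≫ K.arrow g = hom ≫ q), lift g p q e ≫ K.arrow g = q
  natural : ∀ {c d c' d' : P} {g : E.V c d} {g' : E.V c' d'} {y : c ⟶ c'} {z : d ⟶ d'}
    (_ : E.Sq g g' y z) (p : X ⟶ K.base.obj c) (q : Y ⟶ K.base.obj d)
    (e : p ≫ K.arrow g = hom ≫ q)
    (e' : (p ≫ K.base.map y) ≫ K.arrow g' = hom ≫ q ≫ K.base.map z),
    lift g p q e ≫ K.base.map y = lift g' (p ≫ K.base.map y) (q ≫ K.base.map z) e'
  vertical : ∀ {x y z : P} (g' : E.V x y) (g : E.V y z)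
    (p : X ⟶ K.base.obj x) (q : Y ⟶ K.base.obj z)
    (e : p ≫ K.arrow (E.vComp g' g) = hom ≫ q) (e₁ : (p ≫ K.arrow g') ≫ K.arrow g = hom ≫ q)
    (e₂ : p ≫ K.arrow g' = hom ≫ lift g (p ≫ K.arrow g') q e₁),
    lift g' p (lift g (p ≫ K.arrow g') q e₁) e₂ = lift (E.vComp g' g) p q e

theorem LeftLift.ext' {K : DoubleFunctor E (squares C)} {X Y : C} {f g : LeftLift K X Y}
    (h : f.hom = g.hom)
    (h' : ∀ {c d : P} (k : E.V c d) (p : X ⟶ K.base.obj c) (q : Y ⟶ K.base.obj d)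
      (e : p ≫ K.arrow k = f.hom ≫ q) (e' : p ≫ K.arrow k = g.hom ≫ q),
      f.lift k p q e = g.lift k p q e') : f = g := by
  obtain ⟨f, φ, _, _, _, _⟩ := f
  obtain ⟨g, ψ, _, _, _, _⟩ := g
  obtain rfl : f = g := h
  congr
  funext c d k p q e
  exact h' k p q e e

/-- A square of the left class: a commutative square which commutes with the lifting
operations. -/
structure LeftLift.IsSquare {K : DoubleFunctor E (squares C)} {X Y X' Y' : C}
    (f : LeftLift K X Y) (g : LeftLift K X' Y') (s : X ⟶ X') (t : Y ⟶ Y') : Prop where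
  comm : s ≫ g.hom = f.hom ≫ t
  lift : ∀ {c d : P} (k : E.V c d) (p : X' ⟶ K.base.obj c) (q : Y' ⟶ K.base.obj d)
    (e : p ≫ K.arrow k = g.hom ≫ q) (e' : (s ≫ p) ≫ K.arrow k = f.hom ≫ t ≫ q),
    f.lift k (s ≫ p) (t ≫ q) e' = t ≫ g.lift k p q e

theorem LeftLift.lift_congr {K : DoubleFunctor E (squares C)} {X Y : C} (f : LeftLift K X Y)
    {c d : P} (k : E.V c d) {p p' : X ⟶ K.base.obj c} {q q' : Y ⟶ K.base.obj d}
    (hp : p = p') (hq : q = q') (e : p ≫ K.arrow k = f.hom ≫ q)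
    (e' : p' ≫ K.arrow k = f.hom ≫ q') : f.lift k p q e = f.lift k p' q' e' := by
  subst hp hq; rfl

/-- The identity of the left class. -/
def LeftLift.id (K : DoubleFunctor E (squares C)) (X : C) : LeftLift K X X where
  hom := 𝟙 X
  lift _ p _ _ := p
  fac_left _ _ _ _ := Category.id_comp _
  fac_right _ _ _ e := by rw [e, Category.id_comp]
  natural _ _ _ _ _ := rfl
  vertical _ _ _ _ _ _ _ := rfl

/-- Vertical composition in the left class: first lift along `f'`, then along `f`. -/
def LeftLift.comp {K : DoubleFunctor E (squares C)} {X Y Z : C} (f' : LeftLift K X Y)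
    (f : LeftLift K Y Z) : LeftLift K X Z where
  hom := f'.hom ≫ f.hom
  lift k p q e :=
    f.lift k (f'.lift k p (f.hom ≫ q) (by rw [e, Category.assoc])) q (f'.fac_right _ _ _ _)
  fac_left k p q e := by rw [Category.assoc, f.fac_left, f'.fac_left]
  fac_right k p q e := f.fac_right _ _ _ _
  natural {c d c' d' g g' y z} τ p q e e' := by
    have e₀ : p ≫ K.arrow g = f'.hom ≫ f.hom ≫ q := by rw [e, Category.assoc]
    have e₁ : (p ≫ K.base.map y) ≫ K.arrow g' = f'.hom ≫ (f.hom ≫ q) ≫ K.base.map z := by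
      rw [e']; simp only [Category.assoc]
    have h := f'.natural τ p (f.hom ≫ q) e₀ e₁
    rw [f.natural τ _ q (f'.fac_right _ _ _ _) (by
      rw [Category.assoc, K.arrow_sq τ, ← Category.assoc, f'.fac_right, Category.assoc])]
    exact f.lift_congr _ (h.trans (f'.lift_congr _ rfl (Category.assoc _ _ _) _ _)) rfl _ _
  vertical {x y z} g' g p q e e₁ e₂ := by
    have e₃ : (p ≫ K.arrow g') ≫ K.arrow g = f'.hom ≫ f.hom ≫ q := by
      rw [e₁, Category.assoc]
    have e₅ : p ≫ K.arrow (E.vComp g' g) = f'.hom ≫ f.hom ≫ q := by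
      rw [e, Category.assoc]
    have h₁ := f'.vertical g' g p (f.hom ≫ q) e₅ e₃ (f'.fac_left _ _ _ _).symm
    have h₂ : f'.lift (E.vComp g' g) p (f.hom ≫ q) e₅ ≫ K.arrow g' =
        f'.lift g (p ≫ K.arrow g') (f.hom ≫ q) e₃ := by
      rw [← h₁, f'.fac_right]
    have e₆ : f'.lift (E.vComp g' g) p (f.hom ≫ q) e₅ ≫ K.arrow (E.vComp g' g) =
        f.hom ≫ q := f'.fac_right _ _ _ _
    have e₇ : (f'.lift (E.vComp g' g) p (f.hom ≫ q) e₅ ≫ K.arrow g') ≫ K.arrow g =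
        f.hom ≫ q := by rw [Category.assoc, ← K.arrow_comp, e₆]
    rw [← f.vertical g' g _ q e₆ e₇ (f.fac_left _ _ _ _).symm]
    have h₃ := f.lift_congr g h₂.symm rfl (f'.fac_right _ _ _ e₃) e₇
    refine f.lift_congr g' ?_ h₃ _ _
    rw [← h₁]
    exact f'.lift_congr g' rfl (f.fac_left _ _ _ _) _ _

/-- The double category of morphisms with a left lifting operation against `K`. -/
def leftClass (K : DoubleFunctor E (squares C)) : DoubleCategory.{max u₂ v w₂, 0} C where
  V := LeftLift K
  Sq f g s t := PLift (LeftLift.IsSquare f g s t)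
  hId f := ⟨by simp, fun k p q e e' =>
    (f.lift_congr k (Category.id_comp _) (Category.id_comp _) _ e).trans
      (Category.id_comp _).symm⟩
  hComp {_ _ _ _ _ _ f g h s t s' t'} α β := ⟨by
      rw [Category.assoc, β.down.comm, ← Category.assoc, α.down.comm, Category.assoc],
    fun k p q e e' => by
      have e₁ : (s' ≫ p) ≫ K.arrow k = g.hom ≫ t' ≫ q := by
        rw [Category.assoc, e, ← Category.assoc, β.down.comm, Category.assoc]
      have e₂ : (s ≫ s' ≫ p) ≫ K.arrow k = f.hom ≫ t ≫ t' ≫ q := by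
        simpa only [Category.assoc] using e'
      rw [f.lift_congr k (Category.assoc s s' p) (Category.assoc t t' q) e' e₂,
        α.down.lift k (s' ≫ p) (t' ≫ q) e₁ e₂, β.down.lift k p q e e₁, Category.assoc]⟩
  vId := LeftLift.id K
  vComp f g := LeftLift.comp f g
  vIdSq s := ⟨by simp [LeftLift.id], fun _ _ _ _ _ => rfl⟩
  vCompSq {X Y Z X' Y' Z' f g f' g' s t r} α β := ⟨by
      simp only [LeftLift.comp]
      rw [← Category.assoc, α.down.comm, Category.assoc, β.down.comm, Category.assoc],
    fun k p q e e' => by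
      have e₁ : p ≫ K.arrow k = f'.hom ≫ g'.hom ≫ q := e.trans (Category.assoc _ _ _)
      have e₂ : (s ≫ p) ≫ K.arrow k = f.hom ≫ t ≫ g'.hom ≫ q := by
        rw [Category.assoc, e₁, ← Category.assoc, α.down.comm, Category.assoc]
      have h := α.down.lift k p (g'.hom ≫ q) e₁ e₂
      have e₃ : (t ≫ f'.lift k p (g'.hom ≫ q) e₁) ≫ K.arrow k = g.hom ≫ r ≫ q := by
        rw [Category.assoc, f'.fac_right, ← Category.assoc, β.down.comm, Category.assoc]
      have h' := β.down.lift k (f'.lift k p (g'.hom ≫ q) e₁) q (f'.fac_right _ _ _ _) e₃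
      refine Eq.trans (g.lift_congr k ?_ rfl _ _) h'
      rw [← h]
      refine f.lift_congr k rfl ?_ _ _
      rw [← Category.assoc, ← β.down.comm, Category.assoc]⟩
  hId_hComp _ := plift_heq _ _
  hComp_hId _ := plift_heq _ _
  hComp_assoc _ _ _ := plift_heq _ _
  vId_vComp f := LeftLift.ext' (Category.id_comp _) fun _ _ _ _ _ => rfl
  vComp_vId f := LeftLift.ext' (Category.comp_id _) fun k p q e e' =>
    f.lift_congr k rfl (Category.id_comp _) _ _
  vComp_assoc f g h := LeftLift.ext' (Category.assoc _ _ _) fun k p q e e' =>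
    h.lift_congr k (g.lift_congr k (f.lift_congr k rfl (Category.assoc _ _ _).symm _ _) rfl _ _)
      rfl _ _
  vIdSq_vCompSq _ := plift_heq _ _
  vCompSq_vIdSq _ := plift_heq _ _
  vCompSq_assoc _ _ _ := plift_heq _ _
  vIdSq_id _ := rfl
  vIdSq_comp _ _ := rfl
  vCompSq_hId _ _ := rfl
  interchange _ _ _ _ := rfl

/-- The forgetful double functor of the left class. -/
def leftForget (K : DoubleFunctor E (squares C)) : DoubleFunctor (leftClass K) (squares C) where
  base := 𝟭 C
  vert {A B} (f : LeftLift K A B) := f.hom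
  sq {_ _ _ _ f g s t} (α : PLift (LeftLift.IsSquare f g s t)) := ⟨α.down.comm⟩
  vert_id _ := rfl
  vert_comp _ _ := rfl
  sq_hId _ := plift_heq _ _
  sq_hComp _ _ := plift_heq _ _
  sq_vIdSq _ := plift_heq _ _
  sq_vCompSq _ _ := plift_heq _ _

/-- A vertical morphism of the right class of `J`: a morphism of `C` with a lifting operation
against `J`, respecting the squares and the vertical composition of `D`. -/
structure RightLift (J : DoubleFunctor D (squares C)) (X Y : C) where
  hom : X ⟶ Y
  lift : ∀ {a b : O} (f : D.V a b) (p : J.base.obj a ⟶ X) (q : J.base.obj b ⟶ Y),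
    p ≫ hom = J.arrow f ≫ q → (J.base.obj b ⟶ X)
  fac_left : ∀ {a b : O} (f : D.V a b) (p : J.base.obj a ⟶ X) (q : J.base.obj b ⟶ Y)
    (e : p ≫ hom = J.arrow f ≫ q), J.arrow f ≫ lift f p q e = p
  fac_right : ∀ {a b : O} (f : D.V a b) (p : J.base.obj a ⟶ X) (q : J.base.obj b ⟶ Y)
    (e : p ≫ hom = J.arrow f ≫ q), lift f p q e ≫ hom = q
  natural : ∀ {a b a' b' : O} {f' : D.V a' b'} {f : D.V a b} {s : a' ⟶ a} {t : b' ⟶ b}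
    (_ : D.Sq f' f s t) (p : J.base.obj a ⟶ X) (q : J.base.obj b ⟶ Y)
    (e : p ≫ hom = J.arrow f ≫ q)
    (e' : (J.base.map s ≫ p) ≫ hom = J.arrow f' ≫ J.base.map t ≫ q),
    J.base.map t ≫ lift f p q e = lift f' (J.base.map s ≫ p) (J.base.map t ≫ q) e'
  vertical : ∀ {a b c : O} (f' : D.V a b) (f : D.V b c)
    (p : J.base.obj a ⟶ X) (q : J.base.obj c ⟶ Y)
    (e : p ≫ hom = J.arrow (D.vComp f' f) ≫ q) (e₁ : p ≫ hom = J.arrow f' ≫ J.arrow f ≫ q)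
    (e₂ : lift f' p (J.arrow f ≫ q) e₁ ≫ hom = J.arrow f ≫ q),
    lift f (lift f' p (J.arrow f ≫ q) e₁) q e₂ = lift (D.vComp f' f) p q e

theorem RightLift.ext' {J : DoubleFunctor D (squares C)} {X Y : C} {f g : RightLift J X Y}
    (h : f.hom = g.hom)
    (h' : ∀ {a b : O} (j : D.V a b) (p : J.base.obj a ⟶ X) (q : J.base.obj b ⟶ Y)
      (e : p ≫ f.hom = J.arrow j ≫ q) (e' : p ≫ g.hom = J.arrow j ≫ q),
      f.lift j p q e = g.lift j p q e') : f = g := by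
  obtain ⟨f, φ, _, _, _, _⟩ := f
  obtain ⟨g, ψ, _, _, _, _⟩ := g
  obtain rfl : f = g := h
  congr
  funext a b j p q e
  exact h' j p q e e

/-- A square of the right class: a commutative square which commutes with the lifting
operations. -/
structure RightLift.IsSquare {J : DoubleFunctor D (squares C)} {X Y X' Y' : C}
    (f : RightLift J X Y) (g : RightLift J X' Y') (s : X ⟶ X') (t : Y ⟶ Y') : Prop where
  comm : s ≫ g.hom = f.hom ≫ t
  lift : ∀ {a b : O} (j : D.V a b) (p : J.base.obj a ⟶ X) (q : J.base.obj b ⟶ Y)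
    (e : p ≫ f.hom = J.arrow j ≫ q) (e' : (p ≫ s) ≫ g.hom = J.arrow j ≫ q ≫ t),
    g.lift j (p ≫ s) (q ≫ t) e' = f.lift j p q e ≫ s

theorem RightLift.lift_congr {J : DoubleFunctor D (squares C)} {X Y : C} (f : RightLift J X Y)
    {a b : O} (j : D.V a b) {p p' : J.base.obj a ⟶ X} {q q' : J.base.obj b ⟶ Y}
    (hp : p = p') (hq : q = q') (e : p ≫ f.hom = J.arrow j ≫ q)
    (e' : p' ≫ f.hom = J.arrow j ≫ q') : f.lift j p q e = f.lift j p' q' e' := by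
  subst hp hq; rfl

/-- The identity of the right class. -/
def RightLift.id (J : DoubleFunctor D (squares C)) (X : C) : RightLift J X X where
  hom := 𝟙 X
  lift _ _ q _ := q
  fac_left _ _ _ e := by rw [← e, Category.comp_id]
  fac_right _ _ _ _ := Category.comp_id _
  natural _ _ _ _ _ := rfl
  vertical _ _ _ _ _ _ _ := rfl

/-- Vertical composition in the right class: first lift against `g`, then against `g'`. -/
def RightLift.comp {J : DoubleFunctor D (squares C)} {X Y Z : C} (g' : RightLift J X Y)
    (g : RightLift J Y Z) : RightLift J X Z where
  hom := g'.hom ≫ g.hom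
  lift j p q e :=
    g'.lift j p (g.lift j (p ≫ g'.hom) q (by rw [← e, Category.assoc])) (g.fac_left _ _ _ _).symm
  fac_left j p q e := g'.fac_left _ _ _ _
  fac_right j p q e := by rw [← Category.assoc, g'.fac_right, g.fac_right]
  natural {a b a' b' f' f s t} σ p q e e' := by
    have e₀ : (p ≫ g'.hom) ≫ g.hom = J.arrow f ≫ q := by rw [← e, Category.assoc]
    have e₁ : (J.base.map s ≫ p ≫ g'.hom) ≫ g.hom = J.arrow f' ≫ J.base.map t ≫ q := by
      rw [← e']; simp only [Category.assoc]
    have h := g.natural σ (p ≫ g'.hom) q e₀ e₁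
    rw [g'.natural σ p _ (g.fac_left _ _ _ _).symm (by
      rw [← Category.assoc, ← J.arrow_sq σ, Category.assoc, Category.assoc, g.fac_left])]
    exact g'.lift_congr _ rfl
      (h.trans (g.lift_congr _ (Category.assoc _ _ _).symm rfl _ _)) _ _
  vertical {a b c} f' f p q e e₁ e₂ := by
    have e₃ : (p ≫ g'.hom) ≫ g.hom = J.arrow f' ≫ J.arrow f ≫ q := by
      rw [← e₁, Category.assoc]
    have e₅ : (p ≫ g'.hom) ≫ g.hom = J.arrow (D.vComp f' f) ≫ q := by
      rw [← e, Category.assoc]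
    have h₁ := g.vertical f' f (p ≫ g'.hom) q e₅ e₃ (g.fac_right _ _ _ _)
    have h₂ : J.arrow f ≫ g.lift (D.vComp f' f) (p ≫ g'.hom) q e₅ =
        g.lift f' (p ≫ g'.hom) (J.arrow f ≫ q) e₃ := by
      rw [← h₁, g.fac_left]
    have e₆ : p ≫ g'.hom = J.arrow (D.vComp f' f) ≫ g.lift (D.vComp f' f) (p ≫ g'.hom) q e₅ :=
      (g.fac_left _ _ _ _).symm
    have e₇ : p ≫ g'.hom =
        J.arrow f' ≫ J.arrow f ≫ g.lift (D.vComp f' f) (p ≫ g'.hom) q e₅ := by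
      rw [← Category.assoc, ← J.arrow_comp, ← e₆]
    rw [← g'.vertical f' f p _ e₆ e₇ (g'.fac_right _ _ _ _)]
    have h₃ := g'.lift_congr f' rfl h₂.symm (g.fac_left _ _ _ e₃).symm e₇
    refine g'.lift_congr f h₃ ?_ _ _
    rw [← h₁]
    exact g.lift_congr f (g'.fac_right _ _ _ _) rfl _ _

/-- The double category of morphisms with a right lifting operation against `J`. -/
def rightClass (J : DoubleFunctor D (squares C)) : DoubleCategory.{max u₁ v w₁, 0} C where
  V := RightLift J
  Sq f g s t := PLift (RightLift.IsSquare f g s t)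
  hId f := ⟨by simp, fun j p q e e' =>
    (f.lift_congr j (Category.comp_id _) (Category.comp_id _) _ e).trans
      (Category.comp_id _).symm⟩
  hComp {_ _ _ _ _ _ f g h s t s' t'} α β := ⟨by
      rw [Category.assoc, β.down.comm, ← Category.assoc, α.down.comm, Category.assoc],
    fun j p q e e' => by
      have e₁ : (p ≫ s) ≫ g.hom = J.arrow j ≫ q ≫ t := by
        rw [Category.assoc, α.down.comm, ← Category.assoc, e, Category.assoc]
      have e₂ : ((p ≫ s) ≫ s') ≫ h.hom = J.arrow j ≫ (q ≫ t) ≫ t' := by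
        simpa only [Category.assoc] using e'
      rw [h.lift_congr j (Category.assoc p s s').symm (Category.assoc q t t').symm e' e₂,
        β.down.lift j (p ≫ s) (q ≫ t) e₁ e₂, α.down.lift j p q e e₁, Category.assoc]⟩
  vId := RightLift.id J
  vComp f g := RightLift.comp f g
  vIdSq s := ⟨by simp [RightLift.id], fun _ _ _ _ _ => rfl⟩
  vCompSq {X Y Z X' Y' Z' f g f' g' s t r} α β := ⟨by
      simp only [RightLift.comp]
      rw [← Category.assoc, α.down.comm, Category.assoc, β.down.comm, Category.assoc],
    fun j p q e e' => by
      have e₁ : (p ≫ f.hom) ≫ g.hom = J.arrow j ≫ q := (Category.assoc _ _ _).trans e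
      have e₂ : ((p ≫ f.hom) ≫ t) ≫ g'.hom = J.arrow j ≫ q ≫ r := by
        rw [Category.assoc, β.down.comm, ← Category.assoc, e₁, Category.assoc]
      have h := β.down.lift j (p ≫ f.hom) q e₁ e₂
      have e₃ : (p ≫ s) ≫ f'.hom = J.arrow j ≫ g.lift j (p ≫ f.hom) q e₁ ≫ t := by
        rw [← Category.assoc (J.arrow j), g.fac_left, Category.assoc, α.down.comm, Category.assoc]
      have h' := α.down.lift j p (g.lift j (p ≫ f.hom) q e₁) (g.fac_left _ _ _ _).symm e₃
      refine Eq.trans (f'.lift_congr j rfl ?_ _ _) h'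
      rw [← h]
      refine g'.lift_congr j ?_ rfl _ _
      rw [Category.assoc, α.down.comm, Category.assoc]⟩
  hId_hComp _ := plift_heq _ _
  hComp_hId _ := plift_heq _ _
  hComp_assoc _ _ _ := plift_heq _ _
  vId_vComp f := RightLift.ext' (Category.id_comp _) fun j p q e e' =>
    f.lift_congr j (Category.comp_id _) rfl _ _
  vComp_vId f := RightLift.ext' (Category.comp_id _) fun _ _ _ _ _ => rfl
  vComp_assoc f g h := RightLift.ext' (Category.assoc _ _ _) fun j p q e e' =>
    f.lift_congr j rfl
      (g.lift_congr j rfl (h.lift_congr j (Category.assoc _ _ _).symm rfl _ _) _ _) _ _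
  vIdSq_vCompSq _ := plift_heq _ _
  vCompSq_vIdSq _ := plift_heq _ _
  vCompSq_assoc _ _ _ := plift_heq _ _
  vIdSq_id _ := rfl
  vIdSq_comp _ _ := rfl
  vCompSq_hId _ _ := rfl
  interchange _ _ _ _ := rfl

/-- The forgetful double functor of the right class. -/
def rightForget (J : DoubleFunctor D (squares C)) :
    DoubleFunctor (rightClass J) (squares C) where
  base := 𝟭 C
  vert {A B} (f : RightLift J A B) := f.hom
  sq {_ _ _ _ f g s t} (α : PLift (RightLift.IsSquare f g s t)) := ⟨α.down.comm⟩
  vert_id _ := rfl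
  vert_comp _ _ := rfl
  sq_hId _ := plift_heq _ _
  sq_hComp _ _ := plift_heq _ _
  sq_vIdSq _ := plift_heq _ _
  sq_vCompSq _ _ := plift_heq _ _

namespace LiftingOperation

variable {J : DoubleFunctor D (squares C)} {K : DoubleFunctor E (squares C)}
  (φ : LiftingOperation J K)

theorem lift_congr {a b : O} {c d : P} {f f' : D.V a b} {g g' : E.V c d}
    {p p' : J.base.obj a ⟶ K.base.obj c} {q q' : J.base.obj b ⟶ K.base.obj d}
    (hf : f = f') (hg : g = g') (hp : p = p') (hq : q = q')
    (e : p ≫ K.arrow g = J.arrow f ≫ q) (e' : p' ≫ K.arrow g' = J.arrow f' ≫ q') :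
    φ.lift f g p q e = φ.lift f' g' p' q' e' := by
  subst hf hg hp hq; rfl

theorem lift_vId {a : O} {c d : P} (g : E.V c d) (p : J.base.obj a ⟶ K.base.obj c)
    (q : J.base.obj a ⟶ K.base.obj d) (e : p ≫ K.arrow g = J.arrow (D.vId a) ≫ q) :
    φ.lift (D.vId a) g p q e = p := by
  have h := φ.fac_left (D.vId a) g p q e
  rwa [J.arrow_id, Category.id_comp] at h

theorem lift_vId_right {a b : O} {c : P} (f : D.V a b) (p : J.base.obj a ⟶ K.base.obj c)
    (q : J.base.obj b ⟶ K.base.obj c) (e : p ≫ K.arrow (E.vId c) = J.arrow f ≫ q) :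
    φ.lift f (E.vId c) p q e = q := by
  have h := φ.fac_right f (E.vId c) p q e
  rwa [K.arrow_id, Category.comp_id] at h

theorem natural_left {a b a' b' : O} {c d : P} {f' : D.V a' b'} {f : D.V a b} {g : E.V c d}
    {s : a' ⟶ a} {t : b' ⟶ b} (σ : D.Sq f' f s t)
    (p : J.base.obj a ⟶ K.base.obj c) (q : J.base.obj b ⟶ K.base.obj d)
    (e : p ≫ K.arrow g = J.arrow f ≫ q)
    (e' : (J.base.map s ≫ p) ≫ K.arrow g = J.arrow f' ≫ J.base.map t ≫ q) :
    J.base.map t ≫ φ.lift f g p q e =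
      φ.lift f' g (J.base.map s ≫ p) (J.base.map t ≫ q) e' := by
  have h := φ.natural σ (E.hId g) p q e (by simpa using e')
  exact ((by simp : J.base.map t ≫ φ.lift f g p q e =
    J.base.map t ≫ φ.lift f g p q e ≫ K.base.map (𝟙 c))).trans
    (h.trans (φ.lift_congr rfl rfl (by simp) (by simp) _ _))

theorem natural_right {a b : O} {c d c' d' : P} {f : D.V a b} {g : E.V c d} {g' : E.V c' d'}
    {y : c ⟶ c'} {z : d ⟶ d'} (τ : E.Sq g g' y z)
    (p : J.base.obj a ⟶ K.base.obj c) (q : J.base.obj b ⟶ K.base.obj d)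
    (e : p ≫ K.arrow g = J.arrow f ≫ q)
    (e' : (p ≫ K.base.map y) ≫ K.arrow g' = J.arrow f ≫ q ≫ K.base.map z) :
    φ.lift f g p q e ≫ K.base.map y =
      φ.lift f g' (p ≫ K.base.map y) (q ≫ K.base.map z) e' := by
  have h := φ.natural (D.hId f) τ p q e (by simpa using e')
  exact ((by simp : φ.lift f g p q e ≫ K.base.map y =
    J.base.map (𝟙 b) ≫ φ.lift f g p q e ≫ K.base.map y)).trans
    (h.trans (φ.lift_congr rfl rfl (by simp) (by simp) _ _))

/-- The vertical morphism of the left class given by a vertical morphism of `D`. -/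
def leftLift {a b : O} (f : D.V a b) : LeftLift K (J.base.obj a) (J.base.obj b) where
  hom := J.arrow f
  lift g p q e := φ.lift f g p q e
  fac_left g p q e := φ.fac_left f g p q e
  fac_right g p q e := φ.fac_right f g p q e
  natural τ p q e e' := φ.natural_right τ p q e e'
  vertical {x y z} g' g p q e e₁ e₂ := by
    obtain ⟨_, h⟩ := φ.vertical (D.vId a) f g' g p q (by rw [D.vId_vComp]; exact e)
      (by rw [J.arrow_id, Category.id_comp]; exact e) (by rw [D.vId_vComp]; exact e₁)
    refine Eq.trans (φ.lift_congr rfl rfl (φ.lift_vId _ _ _ _).symm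
      (φ.lift_congr (D.vId_vComp f).symm rfl rfl rfl _ _) _ _) (h.trans ?_)
    exact φ.lift_congr (D.vId_vComp f) rfl rfl rfl _ _

/-- The vertical morphism of the right class given by a vertical morphism of `E`. -/
def rightLift {c d : P} (g : E.V c d) : RightLift J (K.base.obj c) (K.base.obj d) where
  hom := K.arrow g
  lift f p q e := φ.lift f g p q e
  fac_left f p q e := φ.fac_left f g p q e
  fac_right f p q e := φ.fac_right f g p q e
  natural σ p q e e' := φ.natural_left σ p q e e'
  vertical {a b c} f' f p q e e₁ e₂ := by
    obtain ⟨_, h⟩ := φ.vertical f' f g (E.vId _) p q (by rw [E.vComp_vId]; exact e)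
      (by rw [E.vComp_vId]; exact e₁) (by rw [K.arrow_id, Category.comp_id]; exact e)
    refine Eq.trans (φ.lift_congr rfl rfl (φ.lift_congr rfl (E.vComp_vId g).symm rfl rfl _ _)
      (φ.lift_vId_right _ _ _ _).symm _ _) (h.trans ?_)
    exact φ.lift_congr rfl (E.vComp_vId g) rfl rfl _ _

/-- The double functor to the left class of `K` induced by a lifting operation. -/
def toLeft : DoubleFunctor D (leftClass K) where
  base := J.base
  vert f := φ.leftLift f
  sq α := ⟨J.arrow_sq α, fun _ p q e e' => (φ.natural_left α p q e e').symm⟩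
  vert_id A := LeftLift.ext' (J.arrow_id A) fun k p q _ _ => φ.lift_vId k p q _
  vert_comp f' f := LeftLift.ext' (J.arrow_comp f' f) fun {c d} k p q e e' => by
    obtain ⟨_, h⟩ := φ.vertical f' f k (E.vId _) p q (by rw [E.vComp_vId]; exact e)
      (by rw [E.vComp_vId, ← Category.assoc, ← J.arrow_comp]; exact e)
      (by rw [K.arrow_id, Category.comp_id]; exact e)
    refine Eq.trans (φ.lift_congr rfl (E.vComp_vId k).symm rfl rfl _ _) (h.symm.trans ?_)
    exact φ.lift_congr rfl rfl (φ.lift_congr rfl (E.vComp_vId k) rfl rfl _ _)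
      (φ.lift_vId_right _ _ _ _) _ _
  sq_hId _ := plift_heq _ _
  sq_hComp _ _ := plift_heq _ _
  sq_vIdSq _ := plift_heq _ _
  sq_vCompSq _ _ := plift_heq _ _

/-- The double functor to the right class of `J` induced by a lifting operation. -/
def toRight : DoubleFunctor E (rightClass J) where
  base := K.base
  vert g := φ.rightLift g
  sq α := ⟨K.arrow_sq α, fun _ p q e e' => (φ.natural_right α p q e e').symm⟩
  vert_id A := RightLift.ext' (K.arrow_id A) fun j p q _ _ => φ.lift_vId_right j p q _
  vert_comp g' g := RightLift.ext' (K.arrow_comp g' g) fun {a b} j p q e e' => by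
    obtain ⟨_, h⟩ := φ.vertical (D.vId _) j g' g p q (by rw [D.vId_vComp]; exact e)
      (by rw [J.arrow_id, Category.id_comp]; exact e)
      (by rw [D.vId_vComp, Category.assoc, ← K.arrow_comp]; exact e)
    refine Eq.trans (φ.lift_congr (D.vId_vComp j).symm rfl rfl rfl _ _) (h.symm.trans ?_)
    exact φ.lift_congr rfl rfl (φ.lift_vId _ _ _ _)
      (φ.lift_congr (D.vId_vComp j) rfl rfl rfl _ _) _ _
  sq_hId _ := plift_heq _ _
  sq_hComp _ _ := plift_heq _ _
  sq_vIdSq _ := plift_heq _ _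
  sq_vCompSq _ _ := plift_heq _ _

/-- The lifting structure `(J, φ, K)` is closed. -/
def Closed : Prop :=
  φ.toLeft.Invertible ∧ φ.toRight.Invertible

theorem slice_comm {A : C} {a b : CostructuredArrow J.base A} {c d : CostructuredArrow K.base A}
    (f : (sliceCat J A).V a b) (g : (sliceCat K A).V c d)
    (p : (J.slice A).base.obj a ⟶ (K.slice A).base.obj c)
    (q : (J.slice A).base.obj b ⟶ (K.slice A).base.obj d)
    (e : p ≫ (K.slice A).arrow g = (J.slice A).arrow f ≫ q) :
    p.left ≫ K.arrow g.1 = J.arrow f.1 ≫ q.left :=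
  congrArg CommaMorphism.left e

/-- The sliced lifting operation. -/
def slice (A : C) : LiftingOperation (J.slice A) (K.slice A) where
  lift {a b c d} f g p q e :=
    Over.homMk (φ.lift f.1 g.1 p.left q.left (slice_comm f g p q e))
      ((congrArg (_ ≫ ·) g.2.symm).trans ((Category.assoc _ _ _).symm.trans
        ((congrArg (· ≫ d.hom) (φ.fac_right f.1 g.1 p.left q.left
          (slice_comm f g p q e))).trans (Over.w q))))
  fac_left f g p q e := by
    apply Over.OverMorphism.ext
    exact φ.fac_left f.1 g.1 p.left q.left (slice_comm f g p q e)
  fac_right f g p q e := by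
    apply Over.OverMorphism.ext
    exact φ.fac_right f.1 g.1 p.left q.left (slice_comm f g p q e)
  natural σ τ p q e e' := by
    apply Over.OverMorphism.ext
    exact φ.natural σ τ p.left q.left (slice_comm _ _ p q e) (slice_comm _ _ _ _ e')
  vertical f' f g' g p q e e₁ e₂ := by
    obtain ⟨e₃, h⟩ := φ.vertical f'.1 f.1 g'.1 g.1 p.left q.left
      (slice_comm _ _ _ _ e) (slice_comm _ _ _ _ e₁) (slice_comm _ _ _ _ e₂)
    exact ⟨Over.OverMorphism.ext e₃, Over.OverMorphism.ext h⟩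

end LiftingOperation

/-- The vertical condition for the canonical lifting operation below. -/
theorem LeftLift.vertical_comp {K : DoubleFunctor E (squares C)} {X Y Z : C}
    (f' : LeftLift K X Y) (f : LeftLift K Y Z) {x y z : P} (g' : E.V x y) (g : E.V y z)
    (p : X ⟶ K.base.obj x) (q : Z ⟶ K.base.obj z)
    (e : p ≫ K.arrow (E.vComp g' g) = (f'.hom ≫ f.hom) ≫ q)
    (e₁ : p ≫ K.arrow (E.vComp g' g) = f'.hom ≫ f.hom ≫ q)
    (e₂ : (p ≫ K.arrow g') ≫ K.arrow g = (f'.hom ≫ f.hom) ≫ q) :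
    ∃ e₃ : f'.lift (E.vComp g' g) p (f.hom ≫ q) e₁ ≫ K.arrow g' =
        f.hom ≫ (LeftLift.comp f' f).lift g (p ≫ K.arrow g') q e₂,
      f.lift g' (f'.lift (E.vComp g' g) p (f.hom ≫ q) e₁)
          ((LeftLift.comp f' f).lift g (p ≫ K.arrow g') q e₂) e₃ =
        (LeftLift.comp f' f).lift (E.vComp g' g) p q e := by
  have h₁ := f'.vertical g' g p (f.hom ≫ q) e₁ (by rw [e₂, Category.assoc])
    (f'.fac_left _ _ _ _).symm
  have h₂ := (LeftLift.comp f' f).vertical g' g p q e e₂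
    ((LeftLift.comp f' f).fac_left _ _ _ _).symm
  have h₃ : f'.lift (E.vComp g' g) p (f.hom ≫ q) e₁ ≫ K.arrow g' =
      f.hom ≫ (LeftLift.comp f' f).lift g (p ≫ K.arrow g') q e₂ := by
    rw [← h₁, f'.fac_right]
    exact (f.fac_left _ _ _ _).symm
  refine ⟨h₃, Eq.trans ?_ h₂⟩
  refine f.lift_congr g' ?_ rfl _ _
  rw [← h₁]
  exact f'.lift_congr g' rfl (f.fac_left _ _ _ _).symm _ _

/-- The canonical lifting operation of the left class of `K` against `K`. -/
def leftOperation (K : DoubleFunctor E (squares C)) : LiftingOperation (leftForget K) K where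
  lift {_ _ _ _} (f : LeftLift K _ _) g p q e := f.lift g p q e
  fac_left {_ _ _ _} (f : LeftLift K _ _) g p q e := f.fac_left g p q e
  fac_right {_ _ _ _} (f : LeftLift K _ _) g p q e := f.fac_right g p q e
  natural {_ _ _ _ _ _ _ _ f' f g g' s t y z} (σ : PLift (LeftLift.IsSquare f' f s t)) τ
      p q e e' := by
    have e₁ : (p ≫ K.base.map y) ≫ K.arrow g' = f.hom ≫ q ≫ K.base.map z := by
      rw [Category.assoc, K.arrow_sq τ, ← Category.assoc, e, Category.assoc]; rfl
    exact (congrArg (t ≫ ·) (f.natural τ p q e e₁)).trans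
      (σ.down.lift g' (p ≫ K.base.map y) (q ≫ K.base.map z) e₁ e').symm
  vertical {_ _ _ _ _ _} (f' : LeftLift K _ _) (f : LeftLift K _ _) g' g p q e e₁ e₂ :=
    LeftLift.vertical_comp f' f g' g p q e e₁ e₂

end Lifting

/-!
The slice `J / A` differs from `J` only in which lifting problems it sees, so each part comes down
to moving lifting structures between `C` and `C / A`.

On the right side nothing is lost: a lifting problem of a vertical morphism of `J` against a
morphism `X ⟶ Y` over `A` lies over `A` as a whole, through `Y`. Hence a lifting structure against
`J / A` is a lifting structure against `J` on a morphism over `A` (`RightLift.ofSlice`), and slicing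
preserves invertibility of the comparison with the right class
(`LiftingOperation.slice_toRight_isBijective`).

On the left side, the vertical morphism `k` of `K` in a lifting problem with bottom `q` from `Y`
need not lie over `A`. When `K` is a comprehension double category with the same base as `C`, the
problem factors through the pullback of `k` along `q`, whose codomain is `Y` and so lies over `A`.
This extends a lifting structure against `K / A` to one against `K` (`LeftLift.ofSlice`). The filler
can be computed from any cartesian square over `k` through which the problem factors
(`LeftLift.liftOver_comp_eq`); applied to vertical composites of cartesian squares, this gives
compatibility with vertical composition. The result is
`LiftingOperation.slice_toLeft_isBijective`, of which the statement about the left class of a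
comprehension double category is the case of the canonical lifting operation.

For a closed lifting structure the comprehension property of `K` is automatic: lifting structures
can be pulled back (`RightLift.ofIsPullback`), so in any double category isomorphic to a right class
the cartesian squares are those on pullback squares
(`DoubleFunctor.IsBijective.isComprehension_comp_rightForget`). For the right class itself this is
the last claim.

Invertibility is handled through the equivalent condition of being bijective on objects, horizontal
morphisms, vertical morphisms and squares (`DoubleFunctor.IsBijective`), so that an inverse double
functor is constructed only once.
-/

/-! ### Invertible and bijective double functors -/

namespace DoubleCategory

variable {O : Type u} [Category.{v} O] (D : DoubleCategory.{w₁, x₁} O)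

theorem vComp_heq {A B F A' B' F' : O} {f : D.V A B} {g : D.V B F} {f' : D.V A' B'}
    {g' : D.V B' F'} (hA : A = A') (hB : B = B') (hF : F = F') (hf : f ≍ f') (hg : g ≍ g') :
    D.vComp f g ≍ D.vComp f' g' := by
  subst hA hB hF hf hg; rfl

theorem hId_heq {A B A' B' : O} {f : D.V A B} {f' : D.V A' B'} (hA : A = A') (hB : B = B')
    (hf : f ≍ f') : D.hId f ≍ D.hId f' := by
  subst hA hB hf; rfl

theorem vIdSq_heq {A B A' B' : O} {s : A ⟶ B} {s' : A' ⟶ B'} (hA : A = A') (hB : B = B')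
    (hs : s ≍ s') : D.vIdSq s ≍ D.vIdSq s' := by
  subst hA hB hs; rfl

theorem hComp_heq {A B A' B' A'' B'' X Y X' Y' X'' Y'' : O}
    {f : D.V A B} {g : D.V A' B'} {h : D.V A'' B''} {s : A ⟶ A'} {t : B ⟶ B'}
    {s' : A' ⟶ A''} {t' : B' ⟶ B''} {f₁ : D.V X Y} {g₁ : D.V X' Y'} {h₁ : D.V X'' Y''}
    {s₁ : X ⟶ X'} {t₁ : Y ⟶ Y'} {s₁' : X' ⟶ X''} {t₁' : Y' ⟶ Y''}
    {α : D.Sq f g s t} {β : D.Sq g h s' t'} {α₁ : D.Sq f₁ g₁ s₁ t₁} {β₁ : D.Sq g₁ h₁ s₁' t₁'}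
    (hA : A = X) (hB : B = Y) (hA' : A' = X') (hB' : B' = Y') (hA'' : A'' = X'') (hB'' : B'' = Y'')
    (hf : f ≍ f₁) (hg : g ≍ g₁) (hh : h ≍ h₁) (hs : s ≍ s₁) (ht : t ≍ t₁) (hs' : s' ≍ s₁')
    (ht' : t' ≍ t₁') (hα : α ≍ α₁) (hβ : β ≍ β₁) : D.hComp α β ≍ D.hComp α₁ β₁ := by
  subst hA hB hA' hB' hA'' hB'' hf hg hh hs ht hs' ht' hα hβ; rfl

theorem vCompSq_heq {A B F A' B' F' X Y Z X' Y' Z' : O}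
    {f : D.V A B} {g : D.V B F} {f' : D.V A' B'} {g' : D.V B' F'}
    {s : A ⟶ A'} {t : B ⟶ B'} {r : F ⟶ F'}
    {f₁ : D.V X Y} {g₁ : D.V Y Z} {f₁' : D.V X' Y'} {g₁' : D.V Y' Z'}
    {s₁ : X ⟶ X'} {t₁ : Y ⟶ Y'} {r₁ : Z ⟶ Z'}
    {α : D.Sq f f' s t} {β : D.Sq g g' t r} {α₁ : D.Sq f₁ f₁' s₁ t₁} {β₁ : D.Sq g₁ g₁' t₁ r₁}
    (hA : A = X) (hB : B = Y) (hF : F = Z) (hA' : A' = X') (hB' : B' = Y') (hF' : F' = Z')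
    (hf : f ≍ f₁) (hg : g ≍ g₁) (hf' : f' ≍ f₁') (hg' : g' ≍ g₁')
    (hs : s ≍ s₁) (ht : t ≍ t₁) (hr : r ≍ r₁) (hα : α ≍ α₁) (hβ : β ≍ β₁) :
    D.vCompSq α β ≍ D.vCompSq α₁ β₁ := by
  subst hA hB hF hA' hB' hF' hf hg hf' hg' hs ht hr hα hβ; rfl

end DoubleCategory

namespace DoubleFunctor

variable {O : Type u₁} [Category.{v₁} O] {P : Type u₂} [Category.{v₂} P]
  {D : DoubleCategory.{w₁, x₁} O} {E : DoubleCategory.{w₂, x₂} P}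

theorem map_heq (G : DoubleFunctor D E) {A B A' B' : O} {s : A ⟶ B} {s' : A' ⟶ B'}
    (hA : A = A') (hB : B = B') (hs : s ≍ s') : G.base.map s ≍ G.base.map s' := by
  subst hA hB hs; rfl

theorem vert_heq (G : DoubleFunctor D E) {A B A' B' : O} {f : D.V A B} {f' : D.V A' B'}
    (hA : A = A') (hB : B = B') (hf : f ≍ f') : G.vert f ≍ G.vert f' := by
  subst hA hB hf; rfl

theorem sq_heq' (G : DoubleFunctor D E) {A B A' B' X Y X' Y' : O} {f : D.V A B} {g : D.V A' B'}
    {s : A ⟶ A'} {t : B ⟶ B'} {f₁ : D.V X Y} {g₁ : D.V X' Y'} {s₁ : X ⟶ X'} {t₁ : Y ⟶ Y'}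
    {α : D.Sq f g s t} {α₁ : D.Sq f₁ g₁ s₁ t₁}
    (hA : A = X) (hB : B = Y) (hA' : A' = X') (hB' : B' = Y')
    (hf : f ≍ f₁) (hg : g ≍ g₁) (hs : s ≍ s₁) (ht : t ≍ t₁) (hα : α ≍ α₁) :
    G.sq α ≍ G.sq α₁ := by
  subst hA hB hA' hB' hf hg hs ht hα; rfl

theorem ext_heq {G H : DoubleFunctor D E} (hobj : ∀ A, G.base.obj A = H.base.obj A)
    (hmap : ∀ {A B : O} (s : A ⟶ B), G.base.map s ≍ H.base.map s)
    (hvert : ∀ {A B : O} (f : D.V A B), G.vert f ≍ H.vert f)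
    (hsq : ∀ {A B A' B' : O} {f : D.V A B} {g : D.V A' B'} {s : A ⟶ A'} {t : B ⟶ B'}
      (α : D.Sq f g s t), G.sq α ≍ H.sq α) : G = H := by
  obtain ⟨G₀, G₁, G₂, _, _, _, _, _, _⟩ := G
  obtain ⟨H₀, H₁, H₂, _, _, _, _, _, _⟩ := H
  obtain rfl : G₀ = H₀ := Functor.hext hobj fun _ _ s => hmap s
  obtain rfl : @G₁ = @H₁ := by
    funext A B f
    exact eq_of_heq (hvert f)
  obtain rfl : @G₂ = @H₂ := by
    funext A B A' B' f g s t α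
    exact eq_of_heq (hsq α)
  rfl

/-- A double functor is bijective if it is bijective on objects and, for each given boundary, on
horizontal morphisms, on vertical morphisms and on squares. -/
structure IsBijective (G : DoubleFunctor D E) : Prop where
  obj : Function.Bijective G.base.obj
  map : ∀ {A B : O}, Function.Bijective (G.base.map : (A ⟶ B) → _)
  vert : ∀ {A B : O}, Function.Bijective (G.vert : D.V A B → _)
  sq : ∀ {A B A' B' : O} {f : D.V A B} {g : D.V A' B'} {s : A ⟶ A'} {t : B ⟶ B'},
    Function.Bijective (G.sq : D.Sq f g s t → _)

theorem isBijective_id (D : DoubleCategory.{w₁, x₁} O) : (DoubleFunctor.id D).IsBijective :=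
  ⟨Function.bijective_id, Function.bijective_id, Function.bijective_id, Function.bijective_id⟩

section OfId

variable {F : DoubleFunctor D D}

theorem obj_of_eq_id (h : F = id D) (A : O) : F.base.obj A = A := by subst h; rfl

theorem map_of_eq_id (h : F = id D) {A B : O} (s : A ⟶ B) : F.base.map s ≍ s := by subst h; rfl

theorem vert_of_eq_id (h : F = id D) {A B : O} (f : D.V A B) : F.vert f ≍ f := by subst h; rfl

theorem sq_of_eq_id (h : F = id D) {A B A' B' : O} {f : D.V A B} {g : D.V A' B'} {s : A ⟶ A'}
    {t : B ⟶ B'} (α : D.Sq f g s t) : F.sq α ≍ α := by subst h; rfl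

end OfId

theorem exists_heq_hom {A B A' B' : O} (hA : A = A') (hB : B = B') (s : A ⟶ B) :
    ∃ s' : A' ⟶ B', s' ≍ s := by
  subst hA hB; exact ⟨s, HEq.rfl⟩

theorem exists_heq_vert {A B A' B' : O} (hA : A = A') (hB : B = B') (f : D.V A B) :
    ∃ f' : D.V A' B', f' ≍ f := by
  subst hA hB; exact ⟨f, HEq.rfl⟩

theorem exists_heq_sq {A B A' B' X Y X' Y' : O} {f : D.V A B} {g : D.V A' B'}
    {s : A ⟶ A'} {t : B ⟶ B'} {f₁ : D.V X Y} {g₁ : D.V X' Y'} {s₁ : X ⟶ X'} {t₁ : Y ⟶ Y'}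
    (hA : A = X) (hB : B = Y) (hA' : A' = X') (hB' : B' = Y')
    (hf : f ≍ f₁) (hg : g ≍ g₁) (hs : s ≍ s₁) (ht : t ≍ t₁) (α : D.Sq f g s t) :
    ∃ α₁ : D.Sq f₁ g₁ s₁ t₁, α₁ ≍ α := by
  subst hA hB hA' hB' hf hg hs ht; exact ⟨α, HEq.rfl⟩

theorem Invertible.isBijective {G : DoubleFunctor D E} (hG : G.Invertible) : G.IsBijective := by
  obtain ⟨H, hD, hE⟩ := hG
  have oD : ∀ A, H.base.obj (G.base.obj A) = A := obj_of_eq_id hD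
  have oE : ∀ A, G.base.obj (H.base.obj A) = A := obj_of_eq_id hE
  have mD : ∀ {A B : O} (s : A ⟶ B), H.base.map (G.base.map s) ≍ s := map_of_eq_id hD
  have mE : ∀ {A B : P} (s : A ⟶ B), G.base.map (H.base.map s) ≍ s := map_of_eq_id hE
  have vD : ∀ {A B : O} (f : D.V A B), H.vert (G.vert f) ≍ f := vert_of_eq_id hD
  have vE : ∀ {A B : P} (f : E.V A B), G.vert (H.vert f) ≍ f := vert_of_eq_id hE
  refine ⟨⟨fun A B h => ?_, fun B => ⟨_, oE B⟩⟩, ⟨fun s t h => ?_, fun s => ?_⟩,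
    ⟨fun f g h => ?_, fun f => ?_⟩, ⟨fun α β h => ?_, fun α => ?_⟩⟩
  · rw [← oD A, h, oD]
  · exact eq_of_heq ((mD s).symm.trans (by rw [h]; exact mD t))
  · obtain ⟨s', hs'⟩ := exists_heq_hom (oD _) (oD _) (H.base.map s)
    exact ⟨s', eq_of_heq ((G.map_heq (oD _).symm (oD _).symm hs').trans (mE s))⟩
  · exact eq_of_heq ((vD f).symm.trans (by rw [h]; exact vD g))
  · obtain ⟨f', hf'⟩ := exists_heq_vert (oD _) (oD _) (H.vert f)
    exact ⟨f', eq_of_heq ((G.vert_heq (oD _).symm (oD _).symm hf').trans (vE f))⟩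
  · exact eq_of_heq ((sq_of_eq_id hD α).symm.trans
      ((heq_of_eq (congrArg H.sq h)).trans (sq_of_eq_id hD β)))
  · obtain ⟨α', hα'⟩ := exists_heq_sq (oD _) (oD _) (oD _) (oD _) (vD _) (vD _) (mD _) (mD _)
      (H.sq α)
    exact ⟨α', eq_of_heq ((G.sq_heq' (oD _).symm (oD _).symm (oD _).symm (oD _).symm (vD _).symm
      (vD _).symm (mD _).symm (mD _).symm hα').trans (sq_of_eq_id hE α))⟩

namespace IsBijective

variable {G : DoubleFunctor D E}

theorem full (hG : G.IsBijective) : G.base.Full := ⟨hG.map.2⟩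

theorem faithful (hG : G.IsBijective) : G.base.Faithful := ⟨fun h => hG.map.1 h⟩

theorem map_inj (hG : G.IsBijective) {A B A' B' : O} {s : A ⟶ B} {s' : A' ⟶ B'}
    (hA : A = A') (hB : B = B') (h : G.base.map s ≍ G.base.map s') : s ≍ s' := by
  subst hA hB; exact heq_of_eq (hG.map.1 (eq_of_heq h))

theorem vert_inj (hG : G.IsBijective) {A B A' B' : O} {f : D.V A B} {f' : D.V A' B'}
    (hA : A = A') (hB : B = B') (h : G.vert f ≍ G.vert f') : f ≍ f' := by
  subst hA hB; exact heq_of_eq (hG.vert.1 (eq_of_heq h))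

theorem sq_inj (hG : G.IsBijective) {A B A' B' X Y X' Y' : O} {f : D.V A B} {g : D.V A' B'}
    {s : A ⟶ A'} {t : B ⟶ B'} {f₁ : D.V X Y} {g₁ : D.V X' Y'} {s₁ : X ⟶ X'} {t₁ : Y ⟶ Y'}
    {α : D.Sq f g s t} {α₁ : D.Sq f₁ g₁ s₁ t₁}
    (hA : A = X) (hB : B = Y) (hA' : A' = X') (hB' : B' = Y')
    (hf : f ≍ f₁) (hg : g ≍ g₁) (hs : s ≍ s₁) (ht : t ≍ t₁) (h : G.sq α ≍ G.sq α₁) :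
    α ≍ α₁ := by
  subst hA hB hA' hB' hf hg hs ht; exact heq_of_eq (hG.sq.1 (eq_of_heq h))

/-- The data of an inverse double functor. It inverts `G` on boundaries only up to equality of
objects, hence the heterogeneous equalities. -/
theorem exists_inverse (hG : G.IsBijective) : ∃ (r : P → O)
    (m : ∀ {A B : P}, (A ⟶ B) → (r A ⟶ r B))
    (k : ∀ {A B : P}, E.V A B → D.V (r A) (r B))
    (c : ∀ {A B A' B' : P} {f : E.V A B} {g : E.V A' B'} {s : A ⟶ A'} {t : B ⟶ B'},
      E.Sq f g s t → D.Sq (k f) (k g) (m s) (m t)),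
    (∀ A, G.base.obj (r A) = A) ∧ (∀ {A B : P} (s : A ⟶ B), G.base.map (m s) ≍ s) ∧
    (∀ {A B : P} (f : E.V A B), G.vert (k f) ≍ f) ∧
    ∀ {A B A' B' : P} {f : E.V A B} {g : E.V A' B'} {s : A ⟶ A'} {t : B ⟶ B'}
      (α : E.Sq f g s t), G.sq (c α) ≍ α := by
  choose r hr using hG.obj.2
  have hm : ∀ {A B : P} (s : A ⟶ B), ∃ s' : r A ⟶ r B, G.base.map s' ≍ s := fun s => by
    obtain ⟨s₁, hs₁⟩ := exists_heq_hom (hr _).symm (hr _).symm s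
    obtain ⟨s₂, rfl⟩ := hG.map.2 s₁
    exact ⟨s₂, hs₁⟩
  choose m hm using @hm
  have hk : ∀ {A B : P} (f : E.V A B), ∃ f' : D.V (r A) (r B), G.vert f' ≍ f := fun f => by
    obtain ⟨f₁, hf₁⟩ := exists_heq_vert (hr _).symm (hr _).symm f
    obtain ⟨f₂, rfl⟩ := hG.vert.2 f₁
    exact ⟨f₂, hf₁⟩
  choose k hk using @hk
  have hc : ∀ {A B A' B' : P} {f : E.V A B} {g : E.V A' B'} {s : A ⟶ A'} {t : B ⟶ B'}
      (α : E.Sq f g s t), ∃ α' : D.Sq (k f) (k g) (m s) (m t), G.sq α' ≍ α := fun α => by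
    obtain ⟨α₁, hα₁⟩ := exists_heq_sq (hr _).symm (hr _).symm (hr _).symm (hr _).symm
      (hk _).symm (hk _).symm (hm _).symm (hm _).symm α
    obtain ⟨α₂, rfl⟩ := hG.sq.2 α₁
    exact ⟨α₂, hα₁⟩
  choose c hc using @hc
  exact ⟨r, m, k, c, hr, hm, hk, hc⟩

/-- A bijective double functor is invertible: every law of the inverse holds because it holds
after applying the given double functor. -/
theorem invertible (hG : G.IsBijective) : G.Invertible := by
  obtain ⟨r, m, k, c, hr, hm, hk, hc⟩ := hG.exists_inverse
  have m_id : ∀ A, m (𝟙 A) = 𝟙 (r A) := fun A => hG.map.1 <| eq_of_heq <| (hm _).trans <| by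
    rw [G.base.map_id, hr]
  have m_comp : ∀ {A B F : P} (s : A ⟶ B) (t : B ⟶ F), m (s ≫ t) = m s ≫ m t := fun s t =>
    hG.map.1 <| eq_of_heq <| (hm _).trans <| by
      rw [G.base.map_comp]
      congr 1 <;> first | exact (hr _).symm | exact (hm _).symm
  have k_id : ∀ A, k (E.vId A) = D.vId (r A) := fun A => hG.vert.1 <| eq_of_heq <|
    (hk _).trans <| by rw [G.vert_id, hr]
  have k_comp : ∀ {A B F : P} (f : E.V A B) (g : E.V B F),
      k (E.vComp f g) = D.vComp (k f) (k g) := fun f g =>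
    hG.vert.1 <| eq_of_heq <| (hk _).trans <| by
      rw [G.vert_comp]
      exact E.vComp_heq (hr _).symm (hr _).symm (hr _).symm (hk _).symm (hk _).symm
  let H : DoubleFunctor E D :=
    { base := { obj := r, map := m, map_id := m_id, map_comp := m_comp }
      vert := k
      sq := c
      vert_id := k_id
      vert_comp := k_comp
      sq_hId := fun f => hG.sq_inj rfl rfl rfl rfl HEq.rfl HEq.rfl (heq_of_eq (m_id _))
        (heq_of_eq (m_id _)) <| (hc _).trans <| HEq.symm <| (G.sq_hId _).trans <|
        E.hId_heq (hr _) (hr _) (hk _)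
      sq_hComp := fun α β => hG.sq_inj rfl rfl rfl rfl HEq.rfl HEq.rfl (heq_of_eq (m_comp _ _))
        (heq_of_eq (m_comp _ _)) <| (hc _).trans <| HEq.symm <| (G.sq_hComp _ _).trans <|
        E.hComp_heq (hr _) (hr _) (hr _) (hr _) (hr _) (hr _) (hk _) (hk _) (hk _) (hm _) (hm _)
          (hm _) (hm _) (hc _) (hc _)
      sq_vIdSq := fun s => hG.sq_inj rfl rfl rfl rfl (heq_of_eq (k_id _)) (heq_of_eq (k_id _))
        HEq.rfl HEq.rfl <| (hc _).trans <| HEq.symm <| (G.sq_vIdSq _).trans <|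
        E.vIdSq_heq (hr _) (hr _) (hm _)
      sq_vCompSq := fun α β => hG.sq_inj rfl rfl rfl rfl (heq_of_eq (k_comp _ _))
        (heq_of_eq (k_comp _ _)) HEq.rfl HEq.rfl <| (hc _).trans <| HEq.symm <|
        (G.sq_vCompSq _ _).trans <|
        E.vCompSq_heq (hr _) (hr _) (hr _) (hr _) (hr _) (hr _) (hk _) (hk _) (hk _) (hk _) (hm _)
          (hm _) (hm _) (hc _) (hc _) }
  have hrG : ∀ A, r (G.base.obj A) = A := fun A => hG.obj.1 (hr _)
  have hmG : ∀ {A B : O} (s : A ⟶ B), m (G.base.map s) ≍ s := fun s =>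
    hG.map_inj (hrG _) (hrG _) (hm _)
  have hkG : ∀ {A B : O} (f : D.V A B), k (G.vert f) ≍ f := fun f =>
    hG.vert_inj (hrG _) (hrG _) (hk _)
  exact ⟨H, ext_heq hrG hmG hkG fun α => hG.sq_inj (hrG _) (hrG _) (hrG _) (hrG _) (hkG _)
    (hkG _) (hmG _) (hmG _) (hc _), ext_heq hr hm hk hc⟩

end IsBijective

end DoubleFunctor

/-! ### Comprehension double categories -/

section Comprehension

variable {C : Type u} [Category.{v} C] {O : Type u₁} [Category.{v₁} O]
  {P : Type u₂} [Category.{v₂} P]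
  {D : DoubleCategory.{w₁, x₁} O} {E : DoubleCategory.{w₂, x₂} P}

/-- The base change of a right lifting structure along a pullback square. -/
noncomputable def RightLift.ofIsPullback {J : DoubleFunctor D (squares C)} {X Y X' Y' : C}
    (g : RightLift J X Y) {s : X' ⟶ X} {k : X' ⟶ Y'} {t : Y' ⟶ Y}
    (h : IsPullback s k g.hom t) : RightLift J X' Y' where
  hom := k
  lift j p q e := h.lift (g.lift j (p ≫ s) (q ≫ t) (by rw [Category.assoc, h.w, reassoc_of% e])) q
    (g.fac_right _ _ _ _)
  fac_left j p q e := by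
    apply h.hom_ext
    · rw [Category.assoc, h.lift_fst, g.fac_left]
    · rw [Category.assoc, h.lift_snd, e]
  fac_right j p q e := h.lift_snd _ _ _
  natural σ p q e e' := by
    apply h.hom_ext
    · rw [Category.assoc, h.lift_fst, h.lift_fst, g.natural σ _ _ _ (by
        rw [Category.assoc, Category.assoc, h.w, ← Category.assoc p, e, Category.assoc,
          ← Category.assoc, ← Category.assoc, J.arrow_sq σ, Category.assoc, Category.assoc])]
      exact g.lift_congr _ (Category.assoc _ _ _).symm (Category.assoc _ _ _).symm _ _
    · rw [Category.assoc, h.lift_snd, h.lift_snd]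
  vertical f' f p q e e₁ e₂ := by
    apply h.hom_ext
    · have e₃ : (p ≫ s) ≫ g.hom = J.arrow (D.vComp f' f) ≫ q ≫ t := by
        rw [Category.assoc, h.w, reassoc_of% e]
      have e₄ : (p ≫ s) ≫ g.hom = J.arrow f' ≫ J.arrow f ≫ q ≫ t := by
        rw [Category.assoc, h.w, reassoc_of% e₁]
      refine (h.lift_fst _ _ _).trans (Eq.trans ?_ (h.lift_fst _ _ _).symm)
      refine Eq.trans ?_ (g.vertical f' f _ _ e₃ e₄ (g.fac_right _ _ _ _))
      exact g.lift_congr _ ((h.lift_fst _ _ _).trans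
        (g.lift_congr _ rfl (Category.assoc _ _ _) _ _)) rfl _ _
    · rw [h.lift_snd, h.lift_snd]

theorem RightLift.ofIsPullback_isSquare {J : DoubleFunctor D (squares C)} {X Y X' Y' : C}
    (g : RightLift J X Y) {s : X' ⟶ X} {k : X' ⟶ Y'} {t : Y' ⟶ Y} (h : IsPullback s k g.hom t) :
    RightLift.IsSquare (g.ofIsPullback h) g s t :=
  ⟨h.w, fun _ _ _ _ _ => (h.lift_fst _ _ _).symm⟩

/-- A square of the right class on a pullback square reflects squares of the right class. -/
theorem RightLift.IsSquare.of_isPullback {J : DoubleFunctor D (squares C)} {X Y X' Y' Z W : C}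
    {k : RightLift J Z W} {g' : RightLift J X' Y'} {g : RightLift J X Y}
    {s : X' ⟶ X} {t : Y' ⟶ Y} {r : Z ⟶ X'} {w : W ⟶ Y'}
    (h : IsPullback s g'.hom g.hom t) (hg : RightLift.IsSquare g' g s t)
    (hk : RightLift.IsSquare k g (r ≫ s) (w ≫ t)) (comm : r ≫ g'.hom = k.hom ≫ w) :
    RightLift.IsSquare k g' r w where
  comm := comm
  lift j p q e e' := by
    apply h.hom_ext
    · have e₁ : ((p ≫ r) ≫ s) ≫ g.hom = J.arrow j ≫ (q ≫ w) ≫ t := by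
        rw [Category.assoc, h.w, ← Category.assoc, e']; simp only [Category.assoc]
      have e₂ : (p ≫ r ≫ s) ≫ g.hom = J.arrow j ≫ q ≫ w ≫ t := by
        simpa only [Category.assoc] using e₁
      refine (hg.lift j _ _ e' e₁).symm.trans (Eq.trans ?_
        ((hk.lift j p q e e₂).trans (Category.assoc _ _ _).symm))
      exact g.lift_congr j (Category.assoc _ _ _) (Category.assoc _ _ _) _ _
    · rw [g'.fac_right, Category.assoc, comm, ← Category.assoc, k.fac_right]

theorem IsHomLift.eq_map {X : Type u₁} {S : Type u₂} [Category.{v₁} X] [Category.{v₂} S]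
    (p : X ⥤ S) {a b : X} {f : p.obj a ⟶ p.obj b} (φ : a ⟶ b) (h : p.IsHomLift f φ) :
    f = p.map φ :=
  IsHomLift.eq_of_isHomLift p f φ

/-- A pullback square is cartesian for the codomain functor of the arrow category. -/
theorem Arrow.isStronglyCartesian_of_isPullback {f g : Arrow C} (α : f ⟶ g)
    (h : IsPullback α.left f.hom g.hom α.right) :
    (Arrow.rightFunc : Arrow C ⥤ C).IsStronglyCartesian (Arrow.rightFunc.map α) α where
  universal_property' {k} (w : k.right ⟶ f.right) τ hτ := by
    have hw : w ≫ α.right = τ.right := IsHomLift.eq_map Arrow.rightFunc τ hτ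
    have e : τ.left ≫ g.hom = (k.hom ≫ w) ≫ α.right := by
      rw [Category.assoc, hw]; exact Arrow.w τ
    refine ⟨Arrow.homMk (h.lift _ _ e) w (h.lift_snd _ _ e), ⟨?_, ?_⟩, ?_⟩
    · exact IsHomLift.map Arrow.rightFunc
        (Arrow.homMk (h.lift _ _ e) w (h.lift_snd _ _ e) : k ⟶ f)
    · ext
      · exact h.lift_fst _ _ e
      · exact hw
    · rintro χ ⟨hχ, hχ'⟩
      have hr : w = χ.right := IsHomLift.eq_map Arrow.rightFunc χ hχ
      ext
      · apply h.hom_ext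
        · exact (congrArg Arrow.Hom.left hχ').trans (h.lift_fst _ _ e).symm
        · exact (Arrow.w χ).trans ((congrArg (k.hom ≫ ·) hr.symm).trans (h.lift_snd _ _ e).symm)
      · exact hr.symm

theorem Arrow.isPullback_of_isStronglyCartesian {f g : Arrow C} (α : f ⟶ g)
    (h : (Arrow.rightFunc : Arrow C ⥤ C).IsStronglyCartesian (Arrow.rightFunc.map α) α) :
    IsPullback α.left f.hom g.hom α.right := by
  have key : ∀ {X : C} (a : X ⟶ g.left) (b : X ⟶ f.right), a ≫ g.hom = b ≫ α.right →
      ∃! l : X ⟶ f.left, l ≫ α.left = a ∧ l ≫ f.hom = b := fun {X} a b e => by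
    let τ : Arrow.mk b ⟶ g := Arrow.homMk a α.right e
    obtain ⟨χ, ⟨hχ, hχ'⟩, huniq⟩ := Functor.IsStronglyCartesian.universal_property Arrow.rightFunc
      (Arrow.rightFunc.map α) α (R' := Arrow.rightFunc.obj (Arrow.mk b)) (𝟙 f.right)
      (Arrow.rightFunc.map τ) (Category.id_comp _).symm τ
    have hr : 𝟙 f.right = χ.right := IsHomLift.eq_map Arrow.rightFunc χ hχ
    refine ⟨χ.left, ⟨congrArg Arrow.Hom.left hχ', ?_⟩, ?_⟩
    · exact (Arrow.w χ).trans ((congrArg (b ≫ ·) hr.symm).trans (Category.comp_id b))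
    · rintro l ⟨hl, hl'⟩
      let ψ : Arrow.mk b ⟶ f := Arrow.homMk l (𝟙 f.right) (hl'.trans (Category.comp_id b).symm)
      refine congrArg Arrow.Hom.left (huniq ψ ⟨IsHomLift.map Arrow.rightFunc ψ, ?_⟩)
      ext
      · exact hl
      · exact Category.id_comp _
  choose l hl huniq using @key
  exact ⟨⟨Arrow.w α⟩, ⟨PullbackCone.IsLimit.mk _ (fun s => l s.fst s.snd s.condition)
    (fun s => (hl _ _ _).1) (fun s => (hl _ _ _).2)
    (fun s m h₁ h₂ => huniq _ _ s.condition m ⟨h₁, h₂⟩)⟩⟩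

namespace DoubleFunctor

variable {K : DoubleFunctor E (squares C)}

theorem IsCartesianSq.isPullback (hK : K.IsComprehension) {f g : E.Vert} {α : f ⟶ g}
    (hα : K.IsCartesianSq α) :
    IsPullback (K.base.map α.top) (K.arrow f.vert) (K.arrow g.vert) (K.base.map α.bot) :=
  Arrow.isPullback_of_isStronglyCartesian _ (hK.cartesian α hα)

/-- A cartesian square is universal among squares over a factorization of their bottom. -/
theorem IsCartesianSq.exists_fac {X Y X' Y' Z W : P} {f : E.V X' Y'} {g : E.V X Y} {k : E.V Z W}
    {s : X' ⟶ X} {t : Y' ⟶ Y} {σ : E.Sq f g s t}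
    (hσ : K.IsCartesianSq (f := ⟨X', Y', f⟩) (g := ⟨X, Y, g⟩) ⟨s, t, σ⟩)
    [K.base.Faithful] {r : Z ⟶ X} (w : W ⟶ Y') (τ : E.Sq k g r (w ≫ t)) :
    ∃ r' : Z ⟶ X', r' ≫ s = r ∧ Nonempty (E.Sq k f r' w) := by
  let τ' : (⟨Z, W, k⟩ : E.Vert) ⟶ ⟨X, Y, g⟩ := ⟨r, w ≫ t, τ⟩
  let α : (⟨X', Y', f⟩ : E.Vert) ⟶ ⟨X, Y, g⟩ := ⟨s, t, σ⟩
  have hα : K.codomain.IsStronglyCartesian (K.codomain.map α) α := hσ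
  obtain ⟨χ, ⟨hχ, hχ'⟩, -⟩ := Functor.IsStronglyCartesian.universal_property K.codomain
    (K.codomain.map α) α (R' := K.codomain.obj ⟨Z, W, k⟩) (K.base.map w) (K.codomain.map τ')
    (K.base.map_comp w t) τ'
  have hw : K.base.map w = K.base.map χ.bot := IsHomLift.eq_map K.codomain χ hχ
  obtain rfl := K.base.map_injective hw
  exact ⟨χ.top, congrArg DoubleCategory.Vert.Hom.top hχ', ⟨χ.sq⟩⟩

/-- If `K` is bijective on objects and faithful, cartesian lifts exist with prescribed bottom and
not only up to an equality of objects in the image of `K`. -/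
theorem IsComprehension.exists_cartesianSq (hK : K.IsComprehension)
    (hobj : Function.Injective K.base.obj) [K.base.Faithful]
    {X Y Y' : P} (g : E.V X Y) (t : Y' ⟶ Y) :
    ∃ (X' : P) (f : E.V X' Y') (s : X' ⟶ X) (σ : E.Sq f g s t),
      K.IsCartesianSq (f := ⟨X', Y', f⟩) (g := ⟨X, Y, g⟩) ⟨s, t, σ⟩ := by
  have := hK.fibration
  obtain ⟨t₀, ht₀⟩ : ∃ t₀ : K.base.obj Y' ⟶ K.codomain.obj ⟨X, Y, g⟩, t₀ = K.base.map t :=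
    ⟨_, rfl⟩
  obtain ⟨f, φ, hφ⟩ := Functor.IsPreFibered.exists_isCartesian' (p := K.codomain) t₀
  have hd := IsHomLift.domain_eq K.codomain t₀ φ
  have hσ := Functor.IsFibered.isStronglyCartesian_of_isCartesian K.codomain t₀ φ
  obtain ⟨X', Y'', f⟩ := f
  obtain rfl : Y'' = Y' := hobj hd
  have ht : t₀ = K.base.map φ.bot := IsHomLift.eq_map K.codomain φ hφ.toIsHomLift
  obtain ⟨s, t', σ⟩ := φ
  rw [ht₀] at ht
  obtain rfl := K.base.map_injective ht
  subst ht₀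
  exact ⟨X', f, s, σ, hσ⟩

/-- A double functor isomorphic over the squares of `C` to the right class of `J` is a comprehension
double category: its cartesian squares are those on pullback squares. -/
theorem IsBijective.isComprehension_comp_rightForget [HasPullbacks C]
    {J : DoubleFunctor D (squares C)} {G : DoubleFunctor E (rightClass J)} (hG : G.IsBijective) :
    (G.comp (rightForget J)).IsComprehension := by
  set K := G.comp (rightForget J) with hK
  -- Squares of the right class are propositions.
  have hsub : ∀ {A B A' B' : P} {f : E.V A B} {g : E.V A' B'} {s : A ⟶ A'} {t : B ⟶ B'}
      (α β : E.Sq f g s t), α = β := fun α β => hG.sq.1 (Subsingleton.elim (α := PLift _) _ _)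
  have hext : ∀ {f g : E.Vert} (α β : f ⟶ g), α.top = β.top → α.bot = β.bot → α = β := by
    rintro f g ⟨s, t, α⟩ ⟨s', t', β⟩ (rfl : s = s') (rfl : t = t')
    rw [hsub α β]
  have hcart : ∀ {f g : E.Vert} (α : f ⟶ g), IsPullback (K.base.map α.top) (K.arrow f.vert)
      (K.arrow g.vert) (K.base.map α.bot) → K.IsCartesianSq α := fun {f g} α h =>
    { universal_property' := fun {k} w' τ hτ => by
        obtain ⟨w, hw⟩ := hG.map.2 w'
        have hw : K.base.map w = w' := hw
        subst hw
        have hb : K.base.map w ≫ K.base.map α.bot = K.base.map τ.bot :=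
          IsHomLift.eq_map K.codomain τ hτ
        have hb' : w ≫ α.bot = τ.bot := hG.map.1 ((K.base.map_comp _ _).trans hb)
        have e : K.base.map τ.top ≫ K.arrow g.vert =
            (K.arrow k.vert ≫ K.base.map w) ≫ K.base.map α.bot := by
          rw [Category.assoc, hb]; exact K.arrow_sq τ.sq
        obtain ⟨r, hr⟩ := hG.map.2 (h.lift _ _ e)
        have hr : K.base.map r = h.lift _ _ e := hr
        have hr' : r ≫ α.top = τ.top := hG.map.1 <| (K.base.map_comp _ _).trans <| by
          rw [hr]; exact h.lift_fst _ _ e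
        obtain ⟨τt, τb, τs⟩ := τ
        obtain rfl : r ≫ α.top = τt := hr'
        obtain rfl : w ≫ α.bot = τb := hb'
        have hsq : RightLift.IsSquare (G.vert k.vert) (G.vert f.vert)
            (G.base.map r) (G.base.map w) := by
          refine RightLift.IsSquare.of_isPullback h (G.sq α.sq).down ?_ ?_
          · have := (G.sq τs).down
            rwa [G.base.map_comp, G.base.map_comp] at this
          · exact (congrArg (· ≫ K.arrow f.vert) hr).trans (h.lift_snd _ _ e)
        obtain ⟨χ, -⟩ := hG.sq.2 ⟨hsq⟩
        refine ⟨⟨r, w, χ⟩, ⟨?_, hext _ _ rfl rfl⟩, ?_⟩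
        · exact IsHomLift.map K.codomain (⟨r, w, χ⟩ : k ⟶ f)
        · rintro ψ ⟨hψ, hψ'⟩
          have hψb : K.base.map w = K.base.map ψ.bot := IsHomLift.eq_map K.codomain ψ hψ
          refine hext _ _ (hG.map.1 (h.hom_ext ?_ ?_)) (hG.map.1 hψb.symm)
          · have : ψ.top ≫ α.top = r ≫ α.top := congrArg DoubleCategory.Vert.Hom.top hψ'
            exact (K.base.map_comp _ _).symm.trans ((congrArg K.base.map this).trans
              (K.base.map_comp _ _))
          · exact (K.arrow_sq ψ.sq).trans ((congrArg (K.arrow k.vert ≫ ·) hψb.symm).trans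
              (K.arrow_sq χ).symm) }
  have hlift : ∀ (g : E.Vert) (R : C) (t : R ⟶ K.codomain.obj g), ∃ (f : E.Vert) (α : f ⟶ g),
      K.codomain.IsStronglyCartesian t α ∧ IsPullback (K.base.map α.top) (K.arrow f.vert)
        (K.arrow g.vert) (K.base.map α.bot) := by
    intro g R t
    obtain ⟨Y, rfl⟩ := hG.obj.2 R
    obtain ⟨t, rfl⟩ := hG.map.2 t
    obtain ⟨Z, s, k, h⟩ : ∃ (Z : C) (s : Z ⟶ K.base.obj g.src) (k : Z ⟶ K.base.obj Y),
        IsPullback s k (K.arrow g.vert) (K.base.map t) :=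
      ⟨_, _, _, IsPullback.of_hasPullback _ _⟩
    obtain ⟨X, rfl⟩ := hG.obj.2 Z
    obtain ⟨s, rfl⟩ := hG.map.2 s
    obtain ⟨f, hf⟩ := hG.vert.2 (RightLift.ofIsPullback (G.vert g.vert) h)
    have hf' : K.arrow f = k := congrArg RightLift.hom hf
    subst hf'
    have hsq : RightLift.IsSquare (G.vert f) (G.vert g.vert) (G.base.map s) (G.base.map t) :=
      hf ▸ RightLift.ofIsPullback_isSquare (G.vert g.vert) h
    obtain ⟨α, -⟩ := hG.sq.2 ⟨hsq⟩
    exact ⟨⟨X, Y, f⟩, ⟨s, t, α⟩, hcart (f := ⟨X, Y, f⟩) ⟨s, t, α⟩ h, h⟩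
  have hpb : ∀ {f g : E.Vert} (α : f ⟶ g), K.IsCartesianSq α → IsPullback (K.base.map α.top)
      (K.arrow f.vert) (K.arrow g.vert) (K.base.map α.bot) := fun {f g} α hα => by
    -- A cartesian square is isomorphic to the pullback lift with the same bottom.
    obtain ⟨f', β, hβ, h⟩ := hlift g _ (K.codomain.map α)
    have hα' : K.codomain.IsStronglyCartesian (K.codomain.map α) α := hα
    let i : f ≅ f' := Functor.IsCartesian.domainUniqueUpToIso K.codomain (K.codomain.map α) β α
    have hi : α = i.hom ≫ β := (Functor.IsCartesian.fac K.codomain (K.codomain.map α) β α).symm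
    apply Arrow.isPullback_of_isStronglyCartesian (K.arr.map α)
    have h₁ := Arrow.isStronglyCartesian_of_isPullback (K.arr.map β) h
    have h₂ : (Arrow.rightFunc : Arrow C ⥤ C).IsStronglyCartesian
      (Arrow.rightFunc.map (K.arr.map i.hom)) (K.arr.map i.hom) := inferInstance
    rw [hi, K.arr.map_comp, Functor.map_comp]
    infer_instance
  refine ⟨.of_exists_isStronglyCartesian fun g R t => ?_, fun α hα => ?_,
    fun {X Y Z X' Y' Z'} g' h' g h s t r α β hα hβ => ?_⟩
  · obtain ⟨f, α, hα, -⟩ := hlift g R t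
    exact ⟨f, α, hα⟩
  · exact Arrow.isStronglyCartesian_of_isPullback _ (hpb α hα)
  · apply hcart
    have := (hpb _ hα).paste_vert (hpb _ hβ)
    rw [← K.arrow_comp, ← K.arrow_comp] at this
    exact this

theorem isComprehension_rightForget [HasPullbacks C] (J : DoubleFunctor D (squares C)) :
    (rightForget J).IsComprehension :=
  (isBijective_id (rightClass J)).isComprehension_comp_rightForget

end DoubleFunctor

/-- If the comparison of `K` with the right class of `J` is invertible, then `K` is a comprehension
double category. -/
theorem LiftingOperation.isComprehension [HasPullbacks C] {J : DoubleFunctor D (squares C)}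
    {K : DoubleFunctor E (squares C)} (φ : LiftingOperation J K) (hφ : φ.toRight.IsBijective) :
    K.IsComprehension :=
  hφ.isComprehension_comp_rightForget

end Comprehension

/-! ### Slicing the right class -/

section SliceBase

variable {C : Type u} [Category.{v} C] {O : Type u₁} [Category.{v₁} O] (F : O ⥤ C) (A : C)

theorem toOver_obj_bijective (hF : Function.Bijective F.obj) :
    Function.Bijective (CostructuredArrow.toOver F A).obj := by
  constructor
  · rintro ⟨X, ⟨⟨⟩⟩, f⟩ ⟨Y, ⟨⟨⟩⟩, g⟩ h
    obtain rfl : X = Y := hF.1 (congrArg Comma.left h)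
    obtain rfl : f = g := by
      injection h with _ _ h
    rfl
  · rintro ⟨X, ⟨⟨⟩⟩, f⟩
    obtain ⟨X, rfl⟩ := hF.2 X
    exact ⟨CostructuredArrow.mk f, rfl⟩

theorem toOver_map_bijective
    (hF : ∀ {X Y : O}, Function.Bijective (F.map : (X ⟶ Y) → _)) {X Y : CostructuredArrow F A} :
    Function.Bijective ((CostructuredArrow.toOver F A).map : (X ⟶ Y) → _) := by
  constructor
  · intro s t h
    apply CostructuredArrow.hom_ext
    exact hF.1 (congrArg CommaMorphism.left h)
  · intro s
    obtain ⟨t, ht⟩ := hF.2 s.left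
    refine ⟨CostructuredArrow.homMk t ((congrArg (· ≫ Y.hom) ht).trans (Over.w s)), ?_⟩
    apply Over.OverMorphism.ext
    exact ht

end SliceBase

section SliceRight

variable {C : Type u} [Category.{v} C] {O : Type u₁} [Category.{v₁} O]
  {P : Type u₂} [Category.{v₂} P]
  {D : DoubleCategory.{w₁, x₁} O} {E : DoubleCategory.{w₂, x₂} P}
  {J : DoubleFunctor D (squares C)} {K : DoubleFunctor E (squares C)} {A : C}

namespace RightLift

variable {X Y : Over A} (R : RightLift (J.slice A) X Y)

theorem over_w {a b : O} {j : D.V a b} {p : J.base.obj a ⟶ X.left} {q : J.base.obj b ⟶ Y.left}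
    (e : p ≫ R.hom.left = J.arrow j ≫ q) : J.arrow j ≫ q ≫ Y.hom = p ≫ X.hom := by
  rw [← Category.assoc, ← e, Category.assoc, Over.w R.hom]

/-- The filler given by a lifting structure in the slice, for a lifting problem in `C`: its left
side lies over `A` through `Y`. -/
def liftLeft {a b : O} (j : D.V a b) (p : J.base.obj a ⟶ X.left) (q : J.base.obj b ⟶ Y.left)
    (e : p ≫ R.hom.left = J.arrow j ≫ q) : J.base.obj b ⟶ X.left :=
  (R.lift (a := CostructuredArrow.mk (p ≫ X.hom)) (b := CostructuredArrow.mk (q ≫ Y.hom))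
    ⟨j, R.over_w e⟩
    (Over.homMk p rfl) (Over.homMk q rfl) (Over.OverMorphism.ext e)).left

theorem lift_left {a b : CostructuredArrow J.base A} (j : (sliceCat J A).V a b)
    (p : (J.slice A).base.obj a ⟶ X) (q : (J.slice A).base.obj b ⟶ Y)
    (e : p ≫ R.hom = (J.slice A).arrow j ≫ q) :
    (R.lift j p q e).left = R.liftLeft j.1 p.left q.left (congrArg CommaMorphism.left e) := by
  obtain ⟨a, ⟨⟨⟩⟩, ha⟩ := a
  obtain ⟨b, ⟨⟨⟩⟩, hb⟩ := b
  obtain ⟨p, hp, rfl⟩ : ∃ (p' : J.base.obj a ⟶ X.left) (hp : p' ≫ X.hom = ha),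
    p = Over.homMk p' hp := ⟨p.left, Over.w p, rfl⟩
  obtain ⟨q, hq, rfl⟩ : ∃ (q' : J.base.obj b ⟶ Y.left) (hq : q' ≫ Y.hom = hb),
    q = Over.homMk q' hq := ⟨q.left, Over.w q, rfl⟩
  subst hp hq
  rfl

theorem liftLeft_natural {a b a' b' : O} {f' : D.V a' b'} {f : D.V a b} {s : a' ⟶ a} {t : b' ⟶ b}
    (σ : D.Sq f' f s t) (p : J.base.obj a ⟶ X.left) (q : J.base.obj b ⟶ Y.left)
    (e : p ≫ R.hom.left = J.arrow f ≫ q)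
    (e' : (J.base.map s ≫ p) ≫ R.hom.left = J.arrow f' ≫ J.base.map t ≫ q) :
    J.base.map t ≫ R.liftLeft f p q e =
      R.liftLeft f' (J.base.map s ≫ p) (J.base.map t ≫ q) e' := by
  have h := congrArg CommaMorphism.left (R.natural
    (a := CostructuredArrow.mk (p ≫ X.hom)) (b := CostructuredArrow.mk (q ≫ Y.hom))
    (a' := CostructuredArrow.mk ((J.base.map s ≫ p) ≫ X.hom))
    (b' := CostructuredArrow.mk ((J.base.map t ≫ q) ≫ Y.hom))
    (f' := ⟨f', R.over_w e'⟩)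
    (f := ⟨f, R.over_w e⟩)
    (s := CostructuredArrow.homMk s (Category.assoc _ _ _).symm)
    (t := CostructuredArrow.homMk t (Category.assoc _ _ _).symm) σ
    (Over.homMk p rfl) (Over.homMk q rfl) (Over.OverMorphism.ext e) (Over.OverMorphism.ext e'))
  exact h

theorem liftLeft_vertical {a b c : O} (f' : D.V a b) (f : D.V b c)
    (p : J.base.obj a ⟶ X.left) (q : J.base.obj c ⟶ Y.left)
    (e : p ≫ R.hom.left = J.arrow (D.vComp f' f) ≫ q)
    (e₁ : p ≫ R.hom.left = J.arrow f' ≫ J.arrow f ≫ q)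
    (e₂ : R.liftLeft f' p (J.arrow f ≫ q) e₁ ≫ R.hom.left = J.arrow f ≫ q) :
    R.liftLeft f (R.liftLeft f' p (J.arrow f ≫ q) e₁) q e₂ =
      R.liftLeft (D.vComp f' f) p q e := by
  let a' : CostructuredArrow J.base A := CostructuredArrow.mk (p ≫ X.hom)
  let b' : CostructuredArrow J.base A := CostructuredArrow.mk ((J.arrow f ≫ q) ≫ Y.hom)
  let c' : CostructuredArrow J.base A := CostructuredArrow.mk (q ≫ Y.hom)
  let F' : (sliceCat J A).V a' b' := ⟨f', R.over_w e₁⟩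
  let F : (sliceCat J A).V b' c' := ⟨f, (Category.assoc _ _ _).symm⟩
  let p' : (J.slice A).base.obj a' ⟶ X := Over.homMk p rfl
  let q' : (J.slice A).base.obj c' ⟶ Y := Over.homMk q rfl
  have h := congrArg CommaMorphism.left (R.vertical F' F p' q' (Over.OverMorphism.ext e)
    (Over.OverMorphism.ext e₁) (Over.OverMorphism.ext e₂))
  exact (R.lift_left F _ _ _).symm.trans h

/-- Lifting structures against `J / A` are lifting structures against `J`, on a morphism over `A`:
every lifting problem in `C` lies over `A`. -/
def ofSlice : RightLift J X.left Y.left where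
  hom := R.hom.left
  lift j p q e := R.liftLeft j p q e
  fac_left j p q e := congrArg CommaMorphism.left (R.fac_left
    (a := CostructuredArrow.mk (p ≫ X.hom)) (b := CostructuredArrow.mk (q ≫ Y.hom))
    ⟨j, R.over_w e⟩ (Over.homMk p rfl) (Over.homMk q rfl) (Over.OverMorphism.ext e))
  fac_right j p q e := congrArg CommaMorphism.left (R.fac_right
    (a := CostructuredArrow.mk (p ≫ X.hom)) (b := CostructuredArrow.mk (q ≫ Y.hom))
    ⟨j, R.over_w e⟩ (Over.homMk p rfl) (Over.homMk q rfl) (Over.OverMorphism.ext e))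
  natural σ p q e e' := R.liftLeft_natural σ p q e e'
  vertical f' f p q e e₁ e₂ := R.liftLeft_vertical f' f p q e e₁ e₂

end RightLift

theorem LiftingOperation.slice_toRight_isBijective (φ : LiftingOperation J K)
    (hφ : φ.toRight.IsBijective) : (φ.slice A).toRight.IsBijective where
  obj := toOver_obj_bijective _ _ hφ.obj
  map := toOver_map_bijective _ _ hφ.map
  vert {X Y} := by
    constructor
    · intro f g h
      have hl : ∀ (f : (sliceCat K A).V X Y), φ.rightLift f.1 =
          RightLift.ofSlice ((φ.slice A).rightLift f) := fun f => rfl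
      exact Subtype.ext (hφ.vert.1 ((hl f).trans
        ((congrArg RightLift.ofSlice h).trans (hl g).symm)))
    · intro R
      obtain ⟨f, hf⟩ := hφ.vert.2 (RightLift.ofSlice R)
      have hhom : K.arrow f = R.hom.left := congrArg RightLift.hom hf
      refine ⟨⟨f, (congrArg (· ≫ Y.hom) hhom).trans (Over.w R.hom)⟩,
        RightLift.ext' (Over.OverMorphism.ext hhom) fun {a b} j p q e e' => ?_⟩
      apply Over.OverMorphism.ext
      rw [R.lift_left]
      have key : ∀ (R₀ : RightLift J (K.base.obj X.left) (K.base.obj Y.left)),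
          φ.rightLift f = R₀ → ∀ (h₁ : p.left ≫ K.arrow f = J.arrow j.1 ≫ q.left)
            (h₂ : p.left ≫ R₀.hom = J.arrow j.1 ≫ q.left),
          φ.lift j.1 f p.left q.left h₁ = R₀.lift j.1 p.left q.left h₂ := by
        rintro _ rfl _ _; rfl
      exact key _ hf _ (congrArg CommaMorphism.left e')
  sq {X Y X' Y' f g s t} := by
    constructor
    · intro α β _
      exact hφ.sq.1 (Subsingleton.elim (α := PLift _) _ _)
    · rintro ⟨h⟩
      have hsq : RightLift.IsSquare (φ.rightLift f.1) (φ.rightLift g.1)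
          (K.base.map s.left) (K.base.map t.left) := by
        refine ⟨congrArg CommaMorphism.left h.comm, fun {a b} j p q e e' => ?_⟩
        have he : J.arrow j ≫ q ≫ Y.hom = p ≫ X.hom := by
          rw [← f.2, ← Category.assoc, ← e]; exact Category.assoc _ _ _
        have := h.lift (a := CostructuredArrow.mk (p ≫ X.hom))
          (b := CostructuredArrow.mk (q ≫ Y.hom)) ⟨j, he⟩ (Over.homMk p rfl) (Over.homMk q rfl)
          (Over.OverMorphism.ext e) (Over.OverMorphism.ext e')
        exact congrArg CommaMorphism.left this
      obtain ⟨α, -⟩ := hφ.sq.2 ⟨hsq⟩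
      exact ⟨α, Subsingleton.elim (α := PLift _) _ _⟩

end SliceRight

/-! ### Slicing the left class -/

section SliceLeft

variable {C : Type u} [Category.{v} C] {O : Type u₁} [Category.{v₁} O]
  {P : Type u₂} [Category.{v₂} P]
  {D : DoubleCategory.{w₁, x₁} O} {E : DoubleCategory.{w₂, x₂} P}
  {J : DoubleFunctor D (squares C)} {K : DoubleFunctor E (squares C)} {A : C}

/-- If `K` is a comprehension double category which is bijective on objects and horizontal
morphisms, then a lifting problem of `h` against `k` is the composite of a problem of `h` against
`k'`, whose bottom is invertible, and a cartesian square `k' ⟶ k`. -/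
theorem DoubleFunctor.IsComprehension.exists_iso_bot (hK : K.IsComprehension)
    (hobj : Function.Bijective K.base.obj)
    [K.base.Full] [K.base.Faithful]
    {X Y : C} (h : X ⟶ Y) {c d : P} (k : E.V c d) (p : X ⟶ K.base.obj c) (q : Y ⟶ K.base.obj d)
    (e : p ≫ K.arrow k = h ≫ q) :
    ∃ (c' d' : P) (k' : E.V c' d') (s : c' ⟶ c) (t : d' ⟶ d) (σ : E.Sq k' k s t)
      (p' : X ⟶ K.base.obj c') (q' : Y ≅ K.base.obj d'),
      K.IsCartesianSq (f := ⟨c', d', k'⟩) (g := ⟨c, d, k⟩) ⟨s, t, σ⟩ ∧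
      p' ≫ K.arrow k' = h ≫ q'.hom ∧ p' ≫ K.base.map s = p ∧ q'.hom ≫ K.base.map t = q := by
  obtain ⟨d', rfl⟩ := hobj.2 Y
  obtain ⟨t, rfl⟩ := K.base.map_surjective q
  obtain ⟨c', k', s, σ, hσ⟩ := hK.exists_cartesianSq hobj.1 k t
  exact ⟨c', d', k', s, t, σ, (hσ.isPullback hK).lift p h e, Iso.refl _, hσ,
    ((hσ.isPullback hK).lift_snd _ _ _).trans (Category.comp_id _).symm,
    (hσ.isPullback hK).lift_fst _ _ _, Category.id_comp _⟩

namespace LeftLift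

variable {X Y : Over A} (L : LeftLift (K.slice A) X Y)

theorem over_w {c d : P} {k : E.V c d} {r : K.base.obj d ⟶ A} {p : X.left ⟶ K.base.obj c}
    {q : Y.left ⟶ K.base.obj d} (e : p ≫ K.arrow k = L.hom.left ≫ q) (hr : q ≫ r = Y.hom) :
    p ≫ K.arrow k ≫ r = X.hom := by
  rw [← Category.assoc, e, Category.assoc, hr, Over.w L.hom]

/-- The filler given by a lifting structure in the slice, for a lifting problem in `C` whose right
side lies over `A` through `r`. -/
def liftOver {c d : P} (k : E.V c d) (r : K.base.obj d ⟶ A) (p : X.left ⟶ K.base.obj c)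
    (q : Y.left ⟶ K.base.obj d) (e : p ≫ K.arrow k = L.hom.left ≫ q) (hr : q ≫ r = Y.hom) :
    Y.left ⟶ K.base.obj c :=
  (L.lift (c := CostructuredArrow.mk (K.arrow k ≫ r)) (d := CostructuredArrow.mk r) ⟨k, rfl⟩
    (Over.homMk p (L.over_w e hr)) (Over.homMk q hr) (Over.OverMorphism.ext e)).left

theorem lift_left {c d : CostructuredArrow K.base A} (k : (sliceCat K A).V c d)
    (p : X ⟶ (K.slice A).base.obj c) (q : Y ⟶ (K.slice A).base.obj d)
    (e : p ≫ (K.slice A).arrow k = L.hom ≫ q) :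
    (L.lift k p q e).left =
      L.liftOver k.1 d.hom p.left q.left (congrArg CommaMorphism.left e) (Over.w q) := by
  obtain ⟨c, ⟨⟨⟩⟩, hc⟩ := c
  obtain ⟨d, ⟨⟨⟩⟩, hd⟩ := d
  obtain ⟨(k : E.V c d), (hk : K.arrow k ≫ hd = hc)⟩ := k
  subst hk
  rfl

theorem liftOver_fac_left {c d : P} (k : E.V c d) (r : K.base.obj d ⟶ A)
    (p : X.left ⟶ K.base.obj c) (q : Y.left ⟶ K.base.obj d)
    (e : p ≫ K.arrow k = L.hom.left ≫ q) (hr : q ≫ r = Y.hom) :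
    L.hom.left ≫ L.liftOver k r p q e hr = p :=
  congrArg CommaMorphism.left (L.fac_left (c := CostructuredArrow.mk (K.arrow k ≫ r))
    (d := CostructuredArrow.mk r) ⟨k, rfl⟩ (Over.homMk p (L.over_w e hr)) (Over.homMk q hr)
    (Over.OverMorphism.ext e))

theorem liftOver_fac_right {c d : P} (k : E.V c d) (r : K.base.obj d ⟶ A)
    (p : X.left ⟶ K.base.obj c) (q : Y.left ⟶ K.base.obj d)
    (e : p ≫ K.arrow k = L.hom.left ≫ q) (hr : q ≫ r = Y.hom) :
    L.liftOver k r p q e hr ≫ K.arrow k = q :=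
  congrArg CommaMorphism.left (L.fac_right (c := CostructuredArrow.mk (K.arrow k ≫ r))
    (d := CostructuredArrow.mk r) ⟨k, rfl⟩ (Over.homMk p (L.over_w e hr)) (Over.homMk q hr)
    (Over.OverMorphism.ext e))

theorem liftOver_natural {c d c' d' : P} {k : E.V c d} {k' : E.V c' d'} {y : c ⟶ c'} {z : d ⟶ d'}
    (τ : E.Sq k k' y z) (r : K.base.obj d ⟶ A) (r' : K.base.obj d' ⟶ A)
    (hz : K.base.map z ≫ r' = r) (p : X.left ⟶ K.base.obj c) (q : Y.left ⟶ K.base.obj d)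
    (e : p ≫ K.arrow k = L.hom.left ≫ q) (hr : q ≫ r = Y.hom)
    (e' : (p ≫ K.base.map y) ≫ K.arrow k' = L.hom.left ≫ q ≫ K.base.map z)
    (hr' : (q ≫ K.base.map z) ≫ r' = Y.hom) :
    L.liftOver k r p q e hr ≫ K.base.map y =
      L.liftOver k' r' (p ≫ K.base.map y) (q ≫ K.base.map z) e' hr' := by
  have hy : K.base.map y ≫ K.arrow k' ≫ r' = K.arrow k ≫ r := by
    rw [← Category.assoc, K.arrow_sq τ, Category.assoc, hz]
  exact congrArg CommaMorphism.left (L.natural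
    (c := CostructuredArrow.mk (K.arrow k ≫ r)) (d := CostructuredArrow.mk r)
    (c' := CostructuredArrow.mk (K.arrow k' ≫ r')) (d' := CostructuredArrow.mk r')
    (g := ⟨k, rfl⟩) (g' := ⟨k', rfl⟩) (y := CostructuredArrow.homMk y hy)
    (z := CostructuredArrow.homMk z hz) τ (Over.homMk p (L.over_w e hr)) (Over.homMk q hr)
    (Over.OverMorphism.ext e) (Over.OverMorphism.ext e'))

theorem liftOver_vertical {x y z : P} (k' : E.V x y) (k : E.V y z) (r : K.base.obj z ⟶ A)
    (p : X.left ⟶ K.base.obj x) (q : Y.left ⟶ K.base.obj z)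
    (e : p ≫ K.arrow (E.vComp k' k) = L.hom.left ≫ q) (hr : q ≫ r = Y.hom)
    (e₁ : (p ≫ K.arrow k') ≫ K.arrow k = L.hom.left ≫ q)
    (e₂ : p ≫ K.arrow k' = L.hom.left ≫ L.liftOver k r (p ≫ K.arrow k') q e₁ hr)
    (hr' : L.liftOver k r (p ≫ K.arrow k') q e₁ hr ≫ K.arrow k ≫ r = Y.hom) :
    L.liftOver k' (K.arrow k ≫ r) p (L.liftOver k r (p ≫ K.arrow k') q e₁ hr) e₂ hr' =
      L.liftOver (E.vComp k' k) r p q e hr := by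
  let x' : CostructuredArrow K.base A := CostructuredArrow.mk (K.arrow k' ≫ K.arrow k ≫ r)
  let y' : CostructuredArrow K.base A := CostructuredArrow.mk (K.arrow k ≫ r)
  let z' : CostructuredArrow K.base A := CostructuredArrow.mk r
  let k₁ : (sliceCat K A).V x' y' := ⟨k', rfl⟩
  let k₀ : (sliceCat K A).V y' z' := ⟨k, rfl⟩
  let p' : X ⟶ (K.slice A).base.obj x' := Over.homMk p (L.over_w e₂ hr')
  let q' : Y ⟶ (K.slice A).base.obj z' := Over.homMk q hr
  have h := congrArg CommaMorphism.left (L.vertical k₁ k₀ p' q' (Over.OverMorphism.ext e)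
    (Over.OverMorphism.ext e₁) (Over.OverMorphism.ext e₂))
  exact h.trans (L.lift_left ((sliceCat K A).vComp k₁ k₀) p' q' (Over.OverMorphism.ext e))

/-- Two reductions of one lifting problem to problems over `A` have the same filler: the first has
an invertible bottom, so it factors through the second, which is along a cartesian square. -/
theorem liftOver_comp_eq (hK : K.IsComprehension)
    [K.base.Full] [K.base.Faithful]
    {c d c' d' c₀ d₀ : P} {k : E.V c d} {k' : E.V c' d'} {k₀ : E.V c₀ d₀}
    {s : c' ⟶ c} {t : d' ⟶ d} {σ : E.Sq k' k s t}
    (hσ : K.IsCartesianSq (f := ⟨c', d', k'⟩) (g := ⟨c, d, k⟩) ⟨s, t, σ⟩)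
    {y : c₀ ⟶ c} {z : d₀ ⟶ d} (τ : E.Sq k₀ k y z)
    {r₀ : K.base.obj d₀ ⟶ A} {p₀ : X.left ⟶ K.base.obj c₀} (q₀ : Y.left ≅ K.base.obj d₀)
    (e₀ : p₀ ≫ K.arrow k₀ = L.hom.left ≫ q₀.hom) (hr₀ : q₀.hom ≫ r₀ = Y.hom)
    {r : K.base.obj d' ⟶ A} {p : X.left ⟶ K.base.obj c'} {q : Y.left ⟶ K.base.obj d'}
    (e : p ≫ K.arrow k' = L.hom.left ≫ q) (hr : q ≫ r = Y.hom)
    (hp : p ≫ K.base.map s = p₀ ≫ K.base.map y)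
    (hq : q ≫ K.base.map t = q₀.hom ≫ K.base.map z) :
    L.liftOver k' r p q e hr ≫ K.base.map s =
      L.liftOver k₀ r₀ p₀ q₀.hom e₀ hr₀ ≫ K.base.map y := by
  obtain ⟨w, hw⟩ := K.base.map_surjective (q₀.inv ≫ q)
  obtain rfl : w ≫ t = z := K.base.map_injective <| by
    rw [K.base.map_comp, hw, Category.assoc, hq, Iso.inv_hom_id_assoc]
  obtain ⟨m, rfl, ⟨ρ⟩⟩ := hσ.exists_fac w τ
  have hqw : q₀.hom ≫ K.base.map w = q := by rw [hw, Iso.hom_inv_id_assoc]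
  have hpm : p₀ ≫ K.base.map m = p := by
    apply (hσ.isPullback hK).hom_ext
    · rw [Category.assoc, ← K.base.map_comp]; exact hp.symm
    · change (p₀ ≫ K.base.map m) ≫ K.arrow k' = p ≫ K.arrow k'
      rw [Category.assoc, K.arrow_sq ρ, ← Category.assoc, e₀, Category.assoc, hqw, e]
  have hwr : K.base.map w ≫ r = r₀ := by
    rw [hw, Category.assoc, hr, ← hr₀, Iso.inv_hom_id_assoc]
  subst hpm hqw
  rw [K.base.map_comp, ← Category.assoc, L.liftOver_natural ρ r₀ r hwr _ _ _ _ e hr]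

/-- `l` is the composite filler of a lifting problem in `C`, for every reduction of that problem
along a cartesian square to one over `A`. -/
def IsFiller {c d : P} (k : E.V c d) (p : X.left ⟶ K.base.obj c) (q : Y.left ⟶ K.base.obj d)
    (l : Y.left ⟶ K.base.obj c) : Prop :=
  ∀ ⦃c' d' : P⦄ ⦃k' : E.V c' d'⦄ ⦃s : c' ⟶ c⦄ ⦃t : d' ⟶ d⦄ (σ : E.Sq k' k s t)
    (_ : K.IsCartesianSq (f := ⟨c', d', k'⟩) (g := ⟨c, d, k⟩) ⟨s, t, σ⟩)
    (r : K.base.obj d' ⟶ A) (p' : X.left ⟶ K.base.obj c') (q' : Y.left ⟶ K.base.obj d')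
    (e : p' ≫ K.arrow k' = L.hom.left ≫ q') (hr : q' ≫ r = Y.hom),
    p' ≫ K.base.map s = p → q' ≫ K.base.map t = q →
      l = L.liftOver k' r p' q' e hr ≫ K.base.map s

theorem exists_isFiller (hK : K.IsComprehension) (hobj : Function.Bijective K.base.obj)
    [K.base.Full] [K.base.Faithful]
    {c d : P} (k : E.V c d) (p : X.left ⟶ K.base.obj c) (q : Y.left ⟶ K.base.obj d)
    (e : p ≫ K.arrow k = L.hom.left ≫ q) : ∃ l, L.IsFiller k p q l := by
  obtain ⟨c₀, d₀, k₀, s, t, σ, p₀, q₀, hσ, e₀, rfl, rfl⟩ :=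
    hK.exists_iso_bot hobj L.hom.left k p q e
  exact ⟨L.liftOver k₀ (q₀.inv ≫ Y.hom) p₀ q₀.hom e₀ (q₀.hom_inv_id_assoc _) ≫ K.base.map s,
    fun _ _ _ _ _ σ' hσ' r p' q' e' hr hp hq =>
      (L.liftOver_comp_eq hK hσ' σ q₀ e₀ _ e' hr hp hq).symm⟩

/-- A lifting structure against `K / A` on a morphism over `A` extends to a lifting structure
against `K`, when `K` is a comprehension double category whose base is that of `C`: a problem
against `k` is solved by the pullback of `k` along the bottom of the problem, which lies
over `A`. -/
noncomputable def ofSlice (hK : K.IsComprehension) (hobj : Function.Bijective K.base.obj)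
    [K.base.Full] [K.base.Faithful] :
    LeftLift K X.left Y.left where
  hom := L.hom.left
  lift k p q e := (L.exists_isFiller hK hobj k p q e).choose
  fac_left k p q e := by
    have hl := (L.exists_isFiller hK hobj k p q e).choose_spec
    obtain ⟨c₀, d₀, k₀, s, t, σ, p₀, q₀, hσ, e₀, hp, hq⟩ :=
      hK.exists_iso_bot hobj L.hom.left k p q e
    rw [hl σ hσ (q₀.inv ≫ Y.hom) p₀ q₀.hom e₀ (q₀.hom_inv_id_assoc _) hp hq, ← Category.assoc,
      L.liftOver_fac_left, hp]
  fac_right k p q e := by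
    have hl := (L.exists_isFiller hK hobj k p q e).choose_spec
    obtain ⟨c₀, d₀, k₀, s, t, σ, p₀, q₀, hσ, e₀, hp, hq⟩ :=
      hK.exists_iso_bot hobj L.hom.left k p q e
    rw [hl σ hσ (q₀.inv ≫ Y.hom) p₀ q₀.hom e₀ (q₀.hom_inv_id_assoc _) hp hq, Category.assoc,
      K.arrow_sq σ, ← Category.assoc, L.liftOver_fac_right, hq]
  natural {c d c' d' g g' y z} τ p q e e' := by
    have hl := (L.exists_isFiller hK hobj g p q e).choose_spec
    have hl' := (L.exists_isFiller hK hobj g' _ _ e').choose_spec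
    obtain ⟨c₀, d₀, k₀, s, t, σ, p₀, q₀, hσ, e₀, hp, hq⟩ :=
      hK.exists_iso_bot hobj L.hom.left g p q e
    obtain ⟨c₁, d₁, k₁, s₁, t₁, σ₁, p₁, q₁, hσ₁, e₁, hp₁, hq₁⟩ :=
      hK.exists_iso_bot hobj L.hom.left g' _ _ e'
    rw [hl σ hσ (q₀.inv ≫ Y.hom) p₀ q₀.hom e₀ (q₀.hom_inv_id_assoc _) hp hq,
      hl' σ₁ hσ₁ (q₁.inv ≫ Y.hom) p₁ q₁.hom e₁ (q₁.hom_inv_id_assoc _) hp₁ hq₁, Category.assoc,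
      ← K.base.map_comp]
    -- The reduction of the problem against `g`, pasted with `τ`, is another reduction of the
    -- problem against `g'`.
    refine (L.liftOver_comp_eq hK hσ₁ (E.hComp σ τ) q₀ e₀ _ e₁ _ ?_ ?_).symm
    · rw [hp₁, K.base.map_comp, ← Category.assoc, hp]
    · rw [hq₁, K.base.map_comp, ← Category.assoc, hq]
  vertical {x y z} g' g p q e e₁ e₂ := by
    have hl := (L.exists_isFiller hK hobj g _ q e₁).choose_spec
    have hl₂ := (L.exists_isFiller hK hobj g' p _ e₂).choose_spec
    have hl₃ := (L.exists_isFiller hK hobj (E.vComp g' g) p q e).choose_spec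
    obtain ⟨c₀, d₀, k₀, s, t, σ, p₀, q₀, hσ, e₀, hp, hq⟩ :=
      hK.exists_iso_bot hobj L.hom.left g _ q e₁
    -- The pullback of `g'` along the top of the square on `g`, so that the two cartesian squares
    -- can be composed vertically.
    obtain ⟨c₁, k₁, s₁, σ₁, hσ₁⟩ := hK.exists_cartesianSq hobj.1 g' s
    have hr := q₀.hom_inv_id_assoc Y.hom
    obtain ⟨p₁, hp₁, rfl⟩ : ∃ p₁ : X.left ⟶ K.base.obj c₁,
        p₁ ≫ K.base.map s₁ = p ∧ p₁ ≫ K.arrow k₁ = p₀ :=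
      ⟨(hσ₁.isPullback hK).lift p p₀ hp.symm, (hσ₁.isPullback hK).lift_fst _ _ _,
        (hσ₁.isPullback hK).lift_snd _ _ _⟩
    have hm := hl σ hσ (q₀.inv ≫ Y.hom) _ q₀.hom e₀ hr hp hq
    have e₃ : p₁ ≫ K.arrow k₁ = L.hom.left ≫ L.liftOver k₀ (q₀.inv ≫ Y.hom) _ q₀.hom e₀ hr :=
      (L.liftOver_fac_left _ _ _ _ _ _).symm
    have hr' : L.liftOver k₀ (q₀.inv ≫ Y.hom) _ q₀.hom e₀ hr ≫ K.arrow k₀ ≫ q₀.inv ≫ Y.hom =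
        Y.hom := by
      rw [← Category.assoc, L.liftOver_fac_right, hr]
    have e₄ : p₁ ≫ K.arrow (E.vComp k₁ k₀) = L.hom.left ≫ q₀.hom := by
      rw [K.arrow_comp, ← Category.assoc, e₀]
    rw [hl₂ σ₁ hσ₁ (K.arrow k₀ ≫ q₀.inv ≫ Y.hom) p₁ _ e₃ hr' hp₁ hm.symm,
      hl₃ (E.vCompSq σ₁ σ) (hK.vertical σ₁ σ hσ₁ hσ) (q₀.inv ≫ Y.hom) p₁ q₀.hom e₄ hr hp₁ hq,
      L.liftOver_vertical k₁ k₀ _ p₁ q₀.hom e₄ hr e₀ e₃ hr']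

theorem ofSlice_lift_eq (hK : K.IsComprehension) (hobj : Function.Bijective K.base.obj)
    [K.base.Full] [K.base.Faithful]
    {c d c' d' : P} {k : E.V c d} {k' : E.V c' d'} {s : c' ⟶ c} {t : d' ⟶ d}
    (σ : E.Sq k' k s t) (hσ : K.IsCartesianSq (f := ⟨c', d', k'⟩) (g := ⟨c, d, k⟩) ⟨s, t, σ⟩)
    (r : K.base.obj d' ⟶ A) {p : X.left ⟶ K.base.obj c} {q : Y.left ⟶ K.base.obj d}
    (p' : X.left ⟶ K.base.obj c') (q' : Y.left ⟶ K.base.obj d')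
    (e : p ≫ K.arrow k = L.hom.left ≫ q) (e' : p' ≫ K.arrow k' = L.hom.left ≫ q')
    (hr : q' ≫ r = Y.hom) (hp : p' ≫ K.base.map s = p) (hq : q' ≫ K.base.map t = q) :
    (L.ofSlice hK hobj).lift k p q e = L.liftOver k' r p' q' e' hr ≫ K.base.map s :=
  (L.exists_isFiller hK hobj k p q e).choose_spec σ hσ r p' q' e' hr hp hq

/-- The extended lifting structure restricts to the given one. -/
theorem ofSlice_lift_eq_liftOver (hK : K.IsComprehension) (hobj : Function.Bijective K.base.obj)
    [K.base.Full] [K.base.Faithful]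
    {c d : P} (k : E.V c d) (r : K.base.obj d ⟶ A) (p : X.left ⟶ K.base.obj c)
    (q : Y.left ⟶ K.base.obj d) (e : p ≫ K.arrow k = L.hom.left ≫ q) (hr : q ≫ r = Y.hom) :
    (L.ofSlice hK hobj).lift k p q e = L.liftOver k r p q e hr := by
  have hid : K.IsCartesianSq (𝟙 (⟨c, d, k⟩ : E.Vert)) :=
    inferInstanceAs (K.codomain.IsStronglyCartesian (K.codomain.map (𝟙 _)) (𝟙 _))
  rw [L.ofSlice_lift_eq hK hobj (E.hId k) hid r p q e e hr (by simp) (by simp), K.base.map_id,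
    Category.comp_id]

end LeftLift

/-- Slicing the lifting structure on `f` given by `φ` and extending it back to `C` recovers it, so
it is determined by its fillers in the slice. -/
theorem LiftingOperation.ofSlice_leftLift (φ : LiftingOperation J K)
    (hK : K.IsComprehension) (hobj : Function.Bijective K.base.obj)
    [K.base.Full] [K.base.Faithful]
    {X Y : CostructuredArrow J.base A} (f : (sliceCat J A).V X Y) :
    ((φ.slice A).leftLift f).ofSlice hK hobj = φ.leftLift f.1 := by
  refine LeftLift.ext' rfl fun {c d} k p q e e' => ?_
  obtain ⟨c₀, d₀, k₀, s, t, σ, p₀, q₀, hσ, e₀, rfl, rfl⟩ :=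
    hK.exists_iso_bot hobj (J.arrow f.1) k p q e'
  exact (((φ.slice A).leftLift f).ofSlice_lift_eq hK hobj σ hσ (q₀.inv ≫ Y.hom) p₀ q₀.hom e e₀
    (q₀.hom_inv_id_assoc Y.hom) rfl rfl).trans (φ.natural_right σ p₀ q₀.hom e₀ e')

theorem LiftingOperation.slice_toLeft_isBijective (φ : LiftingOperation J K)
    (hφ : φ.toLeft.IsBijective) (hK : K.IsComprehension) (hobj : Function.Bijective K.base.obj)
    [K.base.Full] [K.base.Faithful] :
    (φ.slice A).toLeft.IsBijective where
  obj := toOver_obj_bijective _ _ hφ.obj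
  map := toOver_map_bijective _ _ hφ.map
  vert {X Y} := by
    constructor
    · intro f g h
      exact Subtype.ext (hφ.vert.1 ((φ.ofSlice_leftLift hK hobj f).symm.trans
        ((congrArg (LeftLift.ofSlice · hK hobj) h).trans
          (φ.ofSlice_leftLift hK hobj g))))
    · intro L
      obtain ⟨f, hf⟩ := hφ.vert.2 (LeftLift.ofSlice L hK hobj)
      have hhom : J.arrow f = L.hom.left := congrArg LeftLift.hom hf
      refine ⟨⟨f, (congrArg (· ≫ Y.hom) hhom).trans (Over.w L.hom)⟩,
        LeftLift.ext' (Over.OverMorphism.ext hhom) fun {c d} k p q e e' => ?_⟩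
      apply Over.OverMorphism.ext
      rw [L.lift_left]
      have key : ∀ (L₀ : LeftLift K (J.base.obj X.left) (J.base.obj Y.left)),
          φ.leftLift f = L₀ → ∀ (h₁ : p.left ≫ K.arrow k.1 = J.arrow f ≫ q.left)
            (h₂ : p.left ≫ K.arrow k.1 = L₀.hom ≫ q.left),
          φ.lift f k.1 p.left q.left h₁ = L₀.lift k.1 p.left q.left h₂ := by
        rintro _ rfl _ _; rfl
      exact (key _ hf _ (congrArg CommaMorphism.left e')).trans
        (L.ofSlice_lift_eq_liftOver hK hobj k.1 d.hom p.left q.left _ (Over.w q))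
  sq {X Y X' Y' f g s t} := by
    constructor
    · intro α β _
      exact hφ.sq.1 (Subsingleton.elim (α := PLift _) _ _)
    · rintro ⟨h⟩
      have hcomm : J.base.map s.left ≫ J.arrow g.1 = J.arrow f.1 ≫ J.base.map t.left :=
        congrArg CommaMorphism.left h.comm
      have hsq : LeftLift.IsSquare (φ.leftLift f.1) (φ.leftLift g.1)
          (J.base.map s.left) (J.base.map t.left) := by
        refine ⟨hcomm, fun {c d} k p q e e' => ?_⟩
        obtain ⟨c₀, d₀, k₀, s₀, t₀, σ, p₀, q₀, hσ, e₀, rfl, rfl⟩ :=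
          hK.exists_iso_bot hobj (J.arrow g.1) k p q e
        have e₁ : (J.base.map s.left ≫ p₀) ≫ K.arrow k₀ =
            J.arrow f.1 ≫ J.base.map t.left ≫ q₀.hom := by
          rw [Category.assoc, e₀, ← Category.assoc, hcomm, Category.assoc]
        have hr : q₀.hom ≫ q₀.inv ≫ Y'.hom = Y'.hom := q₀.hom_inv_id_assoc _
        have hw := ((φ.slice A).leftLift g).over_w e₀ hr
        have h₁ : φ.lift f.1 k₀ (J.base.map s.left ≫ p₀) (J.base.map t.left ≫ q₀.hom) e₁ =
            J.base.map t.left ≫ φ.lift g.1 k₀ p₀ q₀.hom e₀ :=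
          congrArg CommaMorphism.left (h.lift
            (c := CostructuredArrow.mk (K.arrow k₀ ≫ q₀.inv ≫ Y'.hom))
            (d := CostructuredArrow.mk (q₀.inv ≫ Y'.hom)) ⟨k₀, rfl⟩
            (Over.homMk p₀ hw) (Over.homMk q₀.hom hr)
            (Over.OverMorphism.ext e₀) (Over.OverMorphism.ext e₁))
        have e₂ : ((J.base.map s.left ≫ p₀) ≫ K.base.map s₀) ≫ K.arrow k =
            J.arrow f.1 ≫ (J.base.map t.left ≫ q₀.hom) ≫ K.base.map t₀ :=
          (congrArg (· ≫ _) (Category.assoc _ _ _)).trans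
            (e'.trans (congrArg (_ ≫ ·) (Category.assoc _ _ _).symm))
        have h₂ := φ.natural_right σ _ _ e₁ e₂
        rw [h₁, Category.assoc, φ.natural_right σ p₀ q₀.hom e₀ e] at h₂
        refine Eq.trans ?_ h₂.symm
        exact φ.lift_congr rfl rfl (Category.assoc _ _ _).symm (Category.assoc _ _ _).symm _ _
      obtain ⟨α, -⟩ := hφ.sq.2 ⟨hsq⟩
      exact ⟨α, Subsingleton.elim (α := PLift _) _ _⟩

/-- The comparison induced by the canonical lifting operation of the left class is the identity. -/
theorem leftOperation_toLeft_isBijective (K : DoubleFunctor E (squares C)) :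
    (leftOperation K).toLeft.IsBijective :=
  DoubleFunctor.isBijective_id (leftClass K)

theorem DoubleFunctor.BaseIso.bijective_obj (h : K.BaseIso) : Function.Bijective K.base.obj := by
  obtain ⟨G, h₁, h₂⟩ := h
  exact ⟨Function.LeftInverse.injective (g := G.obj) fun X => congrArg (·.obj X) h₁,
    Function.RightInverse.surjective (g := G.obj) fun X => congrArg (·.obj X) h₂⟩

theorem DoubleFunctor.BaseIso.isEquivalence (h : K.BaseIso) : K.base.IsEquivalence := by
  obtain ⟨G, h₁, h₂⟩ := h
  exact (CategoryTheory.Equivalence.mk K.base G (eqToIso h₁.symm)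
    (eqToIso h₂)).isEquivalence_functor

end SliceLeft

theorem proposition5 {C : Type u} [Category.{v} C] [HasPullbacks C]
    {O : Type u₁} [Category.{v₁} O] {P : Type u₂} [Category.{v₂} P]
    {D : DoubleCategory.{w₁, x₁} O} {E : DoubleCategory.{w₂, x₂} P}
    (J : DoubleFunctor D (squares C)) (K : DoubleFunctor E (squares C)) (A : C) :
    (∀ φ : LiftingOperation J K, φ.Closed → (φ.slice A).Closed) ∧
    (J.IsComprehension → J.BaseIso → ((leftOperation J).slice A).toLeft.Invertible) ∧
    (rightForget J).IsComprehension := by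
  refine ⟨fun φ hφ => ?_, fun hJ hb => ?_, J.isComprehension_rightForget⟩
  · have hr := hφ.2.isBijective
    have : K.base.Full := hr.full
    have : K.base.Faithful := hr.faithful
    exact ⟨(φ.slice_toLeft_isBijective hφ.1.isBijective (φ.isComprehension hr) hr.obj).invertible,
      (φ.slice_toRight_isBijective hr).invertible⟩
  · have := hb.isEquivalence
    exact ((leftOperation J).slice_toLeft_isBijective (leftOperation_toLeft_isBijective J) hJ
      hb.bijective_obj).invertible
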